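/- A deterministic one-tape Turing machine (DTM) has a finite set of states $Q$, a finite working alphabet $\Gamma$ containing the input alphabet $\Sigma$ and a blank symbol that is not in $\Sigma$ and cannot be written, and a partial transition function $\delta : Q\times\Gamma\to Q\times\Gamma\times\{\text{left},\text{right}\}$; it works on a bi-infinite tape and accepts an input if its computation halts (no transition applies) in a final state. It is weight-reducing if there is a partial order on $\Gamma$ such that $\delta(p,\sigma)=(q,\tau,d)$ implies $\tau<\sigma$. It is end-marked if its input is initially surrounded by two special distinct working symbols (neither blank nor input symbols), the left and the right endmarker, the head starts on the left endmarker, and the endmarkers are never overwritten and send the head to the right and to the left, respectively. A weight-reducing Hennie machine is an end-marked DTM that halts on every input $w$ within $O(|w|)$ steps and for which there is a partial order on $\Gamma$ without the two endmarkers such that $\delta(p,\sigma)=(q,\tau,d)$ implies $\tau<\sigma$ whenever $\sigma$ is not an endmarker. The size of a machine or automaton is the number of bits of its transition table together with one bit per state to tell the final states; it is of order $\#Q\cdot\#\Gamma\cdot\log(\#Q\cdot\#\Gamma)$ for a DTM, and of order $\#\Sigma\cdot\#Q\cdot\log(\#Q+1)$ for a DFA with set of states $Q$ and non-empty input alphabet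 $\Sigma$. For $n\ge 0$ let $B_n$ be the language over $\{0,1,\$\}$ of all words $v_1\$v_2\$\cdots\$v_k$ with $k>2$ and $v_1,\dots,v_k\in\{0,1\}^*$ such that $|v_k|\le n$, $|v_i|\ge|v_k|$ for all $i<k$, and $v_j=v_k$ for some $j<k$. Theorem. The size trade-offs from weight-reducing DTMs and from weight-reducing Hennie machines to DFAs are doubly exponential, in the following sense. 1. (Upper bound.) There is a constant $C$ such that every weight-reducing DTM $M$ with set of states $Q$ and working alphabet $\Gamma$ is equivalent to a DFA with at most $2^{2^{C\cdot\#\Gamma\cdot\lfloor\log_2(\#Q+1)\rfloor}}$ states and of size at most $2^{2^{C\cdot\mathrm{size}(M)}}$. The same holds for weight-reducing Hennie machines. 2. (Small machines.) There is a constant $K$ such that, for every $n\ge0$, the language $B_n$ is accepted by a weight-reducing Hennie machine with at most $K$ states, at most $K(n+1)$ working symbols, and size at most $K(n+1)\lfloor\log_2(n+2)\rfloor$. The same holds for weight-reducing DTMs. 3. (Lower bound.) For every $n\ge0$, every DFA (even with a partial transition function) accepting $B_n$ has at least $2^{2^n}$ states. In particular the double exponential upper bound on the number of states is tight: for the machines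 in 2 it is $2^{2^{O(n+1)}}$, while $2^{2^n}$ states are necessary. -/

import Mathlib

universe u v w x

/-- A deterministic one-tape Turing machine with input alphabet `α`, set of states `Q` and working
alphabet `Γ`. The input alphabet is embedded in the working alphabet, the blank symbol is not an
input symbol and cannot be written, and the transition function is partial (`none` means that no
transition applies). -/
structure OneTapeTM (α Q Γ : Type*) where
  inp : α ↪ Γ
  blank : Γ
  inp_ne_blank : ∀ a, inp a ≠ blank
  δ : Q → Γ → Option (Q × Γ × Turing.Dir)
  write_ne_blank : ∀ p s q t d, δ p s = some (q, t, d) → t ≠ blank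
  q₀ : Q
  F : Set Q

/-- A configuration: the state, the contents of the bi-infinite tape, the position of the head. -/
structure TMConfig (Q Γ : Type*) where
  state : Q
  tape : ℤ → Γ
  head : ℤ

/-- The bi-infinite tape holding the word `l` in the cells `0, 1, …`, every other cell being
blank. -/
def tapeOfList {Γ : Type*} (blank : Γ) (l : List Γ) : ℤ → Γ
  | Int.ofNat k => l.getD k blank
  | Int.negSucc _ => blank

namespace OneTapeTM

variable {α Q Γ : Type*}

/-- The successor of a configuration, if there is one. -/
def step (M : OneTapeTM α Q Γ) (c : TMConfig Q Γ) : Option (TMConfig Q Γ) :=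
  (M.δ c.state (c.tape c.head)).map fun r =>
    { state := r.1
      tape := Function.update c.tape c.head r.2.1
      head := match r.2.2 with
        | Turing.Dir.left => c.head - 1
        | Turing.Dir.right => c.head + 1 }

/-- `c'` is reached from `c` in exactly `t` steps. -/
def ReachesIn (M : OneTapeTM α Q Γ) (t : ℕ) (c c' : TMConfig Q Γ) : Prop :=
  (fun o : Option (TMConfig Q Γ) => o.bind M.step)^[t] (some c) = some c'

/-- A halting configuration is a configuration without successor. -/
def IsHalting (M : OneTapeTM α Q Γ) (c : TMConfig Q Γ) : Prop :=
  M.step c = none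

/-- The computation from `c` halts, in a final state. -/
def AcceptsFrom (M : OneTapeTM α Q Γ) (c : TMConfig Q Γ) : Prop :=
  ∃ t c', M.ReachesIn t c c' ∧ M.IsHalting c' ∧ c'.state ∈ M.F

/-- The initial configuration on `w`: the head scans the leftmost symbol of `w`, or a blank cell
if `w` is empty. -/
def init (M : OneTapeTM α Q Γ) (w : List α) : TMConfig Q Γ where
  state := M.q₀
  tape := tapeOfList M.blank (w.map M.inp)
  head := 0

/-- The language accepted by the machine. -/
def language (M : OneTapeTM α Q Γ) : Language α :=
  {w | M.AcceptsFrom (M.init w)}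

/-- The machine is weight-reducing: for some partial order on the working alphabet, each rewriting
is strictly decreasing. -/
def WeightReducing (M : OneTapeTM α Q Γ) : Prop :=
  ∃ _ : PartialOrder Γ, ∀ p s q t d, M.δ p s = some (q, t, d) → t < s

/-- The size of a machine: the number of bits of its transition table, which holds one entry (a
triple in `Q × Γ × {left, right}`, or "undefined") for each state and working symbol, together
with one bit for each state that tells whether it is final. It is of order
`#Q · #Γ · log (#Q · #Γ)`. -/
def size [Fintype Q] [Fintype Γ] (_ : OneTapeTM α Q Γ) : ℕ :=
  Fintype.card Q * Fintype.card Γ * Nat.clog 2 (2 * Fintype.card Q * Fintype.card Γ + 1)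
    + Fintype.card Q

end OneTapeTM

/-- An end-marked deterministic one-tape Turing machine: two special symbols, the left and the right
endmarker, surround the input at the beginning of the computation. They are never overwritten, and
the head never moves to the left of the left one or to the right of the right one. -/
structure EndMarkedTM (α Q Γ : Type*) extends OneTapeTM α Q Γ where
  lend : Γ
  rend : Γ
  lend_ne_rend : lend ≠ rend
  lend_ne_blank : lend ≠ blank
  rend_ne_blank : rend ≠ blank
  inp_ne_lend : ∀ a, inp a ≠ lend
  inp_ne_rend : ∀ a, inp a ≠ rend
  δ_lend : ∀ p q t d, δ p lend = some (q, t, d) → t = lend ∧ d = Turing.Dir.right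
  δ_rend : ∀ p q t d, δ p rend = some (q, t, d) → t = rend ∧ d = Turing.Dir.left

namespace EndMarkedTM

variable {α Q Γ : Type*}

/-- The initial configuration on `w`: the tape contains `w` between the two endmarkers, and the head
scans the left endmarker. -/
def initMarked (M : EndMarkedTM α Q Γ) (w : List α) : TMConfig Q Γ where
  state := M.q₀
  tape := tapeOfList M.blank (M.lend :: (w.map M.inp ++ [M.rend]))
  head := 0

/-- The language accepted by the end-marked machine. -/
def markedLanguage (M : EndMarkedTM α Q Γ) : Language α :=
  {w | M.AcceptsFrom (M.initMarked w)}

/-- The end-marked machine is linear-time, that is, it is a Hennie machine: the computation on each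
input `w` halts within `O(|w|)` steps. -/
def IsHennie (M : EndMarkedTM α Q Γ) : Prop :=
  ∃ K C : ℕ, ∀ w : List α, ∃ t ≤ K * w.length + C, ∃ c',
    M.ReachesIn t (M.initMarked w) c' ∧ M.IsHalting c'

/-- A weight-reducing Hennie machine: a Hennie machine for which there is a partial order on the
working symbols other than the endmarkers such that each rewriting of a cell that does not hold an
endmarker is strictly decreasing. (In particular the written symbol is in the domain of the order,
i.e. it is not an endmarker.) -/
def IsWeightReducingHennie (M : EndMarkedTM α Q Γ) : Prop :=
  M.IsHennie ∧
    ∃ _ : PartialOrder {s : Γ // s ≠ M.lend ∧ s ≠ M.rend},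
      ∀ (p : Q) (s : {s : Γ // s ≠ M.lend ∧ s ≠ M.rend}) (q : Q) (t : Γ) (d : Turing.Dir),
        M.δ p s = some (q, t, d) → ∃ ht : t ≠ M.lend ∧ t ≠ M.rend, ⟨t, ht⟩ < s

end EndMarkedTM

/-- The size of a deterministic finite automaton: the number of bits of its transition table (an
entry is a state or "undefined") together with one bit for each state that tells whether it is
final. It is of order `#α · #σ · log #σ`. -/
def DFA.tableSize {α σ : Type*} [Fintype α] [Fintype σ] (_ : DFA α σ) : ℕ :=
  Fintype.card α * Fintype.card σ * Nat.clog 2 (Fintype.card σ + 1) + Fintype.card σ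

/-- A deterministic finite automaton with a possibly partial transition function: an automaton with
exactly one initial state and with at most one transition for each state and symbol. -/
def NFA.IsPartialDFA {α σ : Type*} (A : NFA α σ) : Prop :=
  (∃ q₀, A.start = {q₀}) ∧ ∀ q a, (A.step q a).Subsingleton

/-- The language `B_n` over the alphabet `{0, 1, $}`, where `some false`, `some true` and `none`
stand for `0`, `1` and `$`: all words `v₁ $ v₂ $ ⋯ $ v_k` with `k > 2` and binary blocks `v_i`, such
that `|v_k| ≤ n`, `|v_i| ≥ |v_k|` for all `i < k`, and `v_j = v_k` for some `j < k`. Here `us` is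
the list of the blocks `v₁, …, v_{k-1}` and `v` is the block `v_k`. -/
def blockLanguage (n : ℕ) : Language (Option Bool) :=
  {w | ∃ (us : List (List Bool)) (v : List Bool),
    w = List.intercalate [none] ((us ++ [v]).map (List.map some)) ∧
    2 < (us ++ [v]).length ∧ v.length ≤ n ∧ (∀ u ∈ us, v.length ≤ u.length) ∧ v ∈ us}

/-!
The size trade-offs from weight-reducing one-tape machines to deterministic automata.

*Upper bound.* Cut the tape at the end of a nonempty prefix `u` of the input. What the part of the
tape that holds `u` contributes to the computation is the state in which the head leaves it for the
first time, and then its reaction to each entry through the cut: a state in which the head comes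
back, an accepting halt, or neither. Each entry visits the last cell of `u` and decreases its
symbol, so there are at most `#Γ` entries, and two prefixes which react in the same way to `#Γ`
entries have the same left quotient (`OneTapeTM.Simulates.acceptsFrom`,
`OneTapeTM.languageBetween_of_signature_eq`). The number of possible reactions to `k` entries obeys
the recursion `N (k + 1) = (#Q * N k + 2) ^ #Q` (`OneTapeTM.exists_classification`), whose solution is
doubly exponential in `k * log #Q` (`OneTapeTM.behaviours_bound`). The left quotients are the states
of an automaton for the language. Neither a bound on the space nor one on the time enters, and in an
end-marked machine the last cell of `u` is never an endmarker, so one argument serves both models.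

*Lower bound.* A set `S` of binary words of length `n` is encoded by a word whose blocks are the
elements of `S` and two longer blocks. A further block `v` of length `n` leads to a word of the block
language if and only if `v ∈ S`, so the `2 ^ 2 ^ n` encodings have different left quotients. All of
them can be extended to words of the language, which rules out that a partial automaton saves a
state (`NFA.IsPartialDFA.card_le`).

*Small machines.* The machine sweeps over the input to and fro. In each sweep from right to left it
picks the rightmost unprocessed bit of the last block and compares it with the rightmost unprocessed
bit of every other block, rejecting if there is none; the processed bits are replaced by the results
of the comparisons. When the last block has been used up, one more sweep looks for another block
without unprocessed bits and without negative results. Every cell carries a counter that each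
rewriting decreases. This makes the machine weight-reducing and linear-time. The initial value of
the counter allows `n + 1` rounds, which is just enough for a last block of length `n`, so the
exhaustion of the counter also enforces the bound on this length (`BlockMachine.verdict_blocks`,
`BlockMachine.exists_reachesIn_halting`). Without endmarkers, the blank cells next to the input are
given counters at their first visit and then serve as endmarkers.
-/

namespace OneTapeTM

variable {α Q Γ : Type*}

/-! ### Computations and half tapes -/

/-- The machine halts in a final state after exactly `t` steps from `c`. -/
def AcceptsIn (M : OneTapeTM α Q Γ) (t : ℕ) (c : TMConfig Q Γ) : Prop :=
  ∃ c', M.ReachesIn t c c' ∧ M.IsHalting c' ∧ c'.state ∈ M.F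

theorem acceptsFrom_iff_exists_acceptsIn {M : OneTapeTM α Q Γ} {c : TMConfig Q Γ} :
    M.AcceptsFrom c ↔ ∃ t, M.AcceptsIn t c := Iff.rfl

theorem reachesIn_zero {M : OneTapeTM α Q Γ} {c c' : TMConfig Q Γ} :
    M.ReachesIn 0 c c' ↔ c = c' := by
  simp [ReachesIn]

theorem iterate_bind_none (M : OneTapeTM α Q Γ) (t : ℕ) :
    (fun o : Option (TMConfig Q Γ) => o.bind M.step)^[t] none = none := by
  induction t with
  | zero => rfl
  | succ t ih => rw [Function.iterate_succ_apply]; exact ih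

theorem reachesIn_succ {M : OneTapeTM α Q Γ} {t : ℕ} {c c' : TMConfig Q Γ} :
    M.ReachesIn (t + 1) c c' ↔ ∃ d, M.step c = some d ∧ M.ReachesIn t d c' := by
  unfold ReachesIn
  rw [Function.iterate_succ_apply]
  cases h : M.step c with
  | none => simp [h, iterate_bind_none]
  | some d => simp [h]

theorem ReachesIn.head {M : OneTapeTM α Q Γ} {t : ℕ} {c d c' : TMConfig Q Γ}
    (h : M.step c = some d) (hd : M.ReachesIn t d c') : M.ReachesIn (t + 1) c c' :=
  reachesIn_succ.2 ⟨d, h, hd⟩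

theorem ReachesIn.trans {M : OneTapeTM α Q Γ} {s t : ℕ} {c d e : TMConfig Q Γ}
    (h₁ : M.ReachesIn s c d) (h₂ : M.ReachesIn t d e) : M.ReachesIn (s + t) c e := by
  unfold ReachesIn at *
  rw [add_comm, Function.iterate_add_apply, h₁, h₂]

/-- A computation reaches at most one halting configuration. -/
theorem ReachesIn.halting_unique {M : OneTapeTM α Q Γ} {s t : ℕ} {c d e : TMConfig Q Γ}
    (h₁ : M.ReachesIn s c d) (hd : M.IsHalting d) (h₂ : M.ReachesIn t c e) (he : M.IsHalting e) :
    d = e := by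
  induction s generalizing t c with
  | zero =>
    rw [reachesIn_zero] at h₁
    subst h₁
    cases t with
    | zero => exact reachesIn_zero.1 h₂
    | succ t =>
      obtain ⟨d', h, -⟩ := reachesIn_succ.1 h₂
      rw [IsHalting, h] at hd
      cases hd
  | succ s ih =>
    obtain ⟨d', h, h'⟩ := reachesIn_succ.1 h₁
    cases t with
    | zero =>
      rw [reachesIn_zero] at h₂
      subst h₂
      rw [IsHalting, h] at he
      cases he
    | succ t =>
      obtain ⟨e', k, k'⟩ := reachesIn_succ.1 h₂
      rw [h] at k
      cases k
      exact ih h' k'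

theorem acceptsIn_zero {M : OneTapeTM α Q Γ} {c : TMConfig Q Γ} :
    M.AcceptsIn 0 c ↔ M.IsHalting c ∧ c.state ∈ M.F := by
  simp [AcceptsIn, reachesIn_zero]

theorem acceptsIn_succ {M : OneTapeTM α Q Γ} {t : ℕ} {c : TMConfig Q Γ} :
    M.AcceptsIn (t + 1) c ↔ ∃ d, M.step c = some d ∧ M.AcceptsIn t d := by
  simp only [AcceptsIn, reachesIn_succ]
  constructor
  · rintro ⟨c', ⟨d, h, h'⟩, hc⟩
    exact ⟨d, h, c', h', hc⟩
  · rintro ⟨d, h, c', h', hc⟩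
    exact ⟨c', ⟨d, h, h'⟩, hc⟩

theorem AcceptsFrom.head {M : OneTapeTM α Q Γ} {c d : TMConfig Q Γ}
    (h : M.step c = some d) (hd : M.AcceptsFrom d) : M.AcceptsFrom c := by
  obtain ⟨t, ht⟩ := acceptsFrom_iff_exists_acceptsIn.1 hd
  exact acceptsFrom_iff_exists_acceptsIn.2 ⟨t + 1, acceptsIn_succ.2 ⟨d, h, ht⟩⟩

theorem AcceptsFrom.of_halting {M : OneTapeTM α Q Γ} {c : TMConfig Q Γ}
    (h : M.IsHalting c) (hF : c.state ∈ M.F) : M.AcceptsFrom c :=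
  acceptsFrom_iff_exists_acceptsIn.2 ⟨0, acceptsIn_zero.2 ⟨h, hF⟩⟩

end OneTapeTM

/-- The tape cut into two half tapes at the boundary between the cells `b - 1` and `b`. Both halves
are indexed by the distance from the boundary, so that `l 0` is the content of the cell `b - 1` and
`r 0` that of the cell `b`. -/
def glue {Γ : Type*} (b : ℤ) (l r : ℕ → Γ) (z : ℤ) : Γ :=
  if z < b then l (b - 1 - z).toNat else r (z - b).toNat

/-- The configuration whose head is in the left half tape, at distance `i` from the boundary. -/
def leftConfig {Q Γ : Type*} (b : ℤ) (q : Q) (l r : ℕ → Γ) (i : ℕ) : TMConfig Q Γ :=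
  ⟨q, glue b l r, b - 1 - i⟩

/-- The configuration whose head is in the right half tape, at distance `i` from the boundary. -/
def rightConfig {Q Γ : Type*} (b : ℤ) (q : Q) (l r : ℕ → Γ) (i : ℕ) : TMConfig Q Γ :=
  ⟨q, glue b l r, b + i⟩

section Glue

variable {Γ : Type*} (b : ℤ) (l r : ℕ → Γ)

theorem glue_left (i : ℕ) : glue b l r (b - 1 - i) = l i := by
  have h : b - 1 - (i : ℤ) < b := by omega
  have h' : (b - 1 - (b - 1 - (i : ℤ))).toNat = i := by omega
  rw [glue, if_pos h, h']

theorem glue_right (i : ℕ) : glue b l r (b + i) = r i := by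
  have h : ¬ b + (i : ℤ) < b := by omega
  have h' : (b + (i : ℤ) - b).toNat = i := by omega
  rw [glue, if_neg h, h']

theorem update_glue_left (i : ℕ) (a : Γ) :
    Function.update (glue b l r) (b - 1 - i) a = glue b (Function.update l i a) r := by
  funext z
  by_cases hz : z = b - 1 - i
  · subst hz
    rw [glue_left]
    simp
  · rw [Function.update_of_ne hz]
    unfold glue
    split_ifs with h
    · rw [Function.update_of_ne]
      omega
    · rfl

theorem update_glue_right (i : ℕ) (a : Γ) :
    Function.update (glue b l r) (b + i) a = glue b l (Function.update r i a) := by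
  funext z
  by_cases hz : z = b + i
  · subst hz
    rw [glue_right]
    simp
  · rw [Function.update_of_ne hz]
    unfold glue
    split_ifs with h
    · rfl
    · rw [Function.update_of_ne]
      omega

/-- A word whose part `x` lies to the left of the boundary and whose part `y` lies to the right. -/
theorem tapeOfList_append (blank : Γ) (x y : List Γ) :
    tapeOfList blank (x ++ y) =
      glue x.length (fun i => x.reverse.getD i blank) (fun i => y.getD i blank) := by
  funext z
  unfold glue
  cases z with
  | ofNat k =>
    simp only [tapeOfList, Int.ofNat_eq_natCast]
    split_ifs with h
    · have hk : k < x.length := by omega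
      have e : ((x.length : ℤ) - 1 - k).toNat = x.length - 1 - k := by omega
      have e' : x.length - 1 - (x.length - 1 - k) = k := by omega
      have hk' : x.length - 1 - k < x.reverse.length := by simp; omega
      rw [e, List.getD_append _ _ _ _ hk, List.getD_eq_getElem _ _ hk,
        List.getD_eq_getElem _ _ hk', List.getElem_reverse]
      simp only [e']
    · have e : ((k : ℤ) - x.length).toNat = k - x.length := by omega
      rw [e, List.getD_append_right _ _ _ _ (by omega)]
  | negSucc k =>
    have h : Int.negSucc k < (x.length : ℤ) := by omega
    have h' : x.reverse.length ≤ ((x.length : ℤ) - 1 - Int.negSucc k).toNat := by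
      rw [List.length_reverse]; omega
    rw [if_pos h]
    exact (List.getD_eq_default _ _ h').symm

end Glue

namespace OneTapeTM

variable {α Q Γ : Type*} (M : OneTapeTM α Q Γ) (b : ℤ) {q q' : Q} {a : Γ} (l r : ℕ → Γ) {i : ℕ}

theorem isHalting_leftConfig : M.IsHalting (leftConfig b q l r i) ↔ M.δ q (l i) = none := by
  simp [IsHalting, step, leftConfig, glue_left]

theorem isHalting_rightConfig : M.IsHalting (rightConfig b q l r i) ↔ M.δ q (r i) = none := by
  simp [IsHalting, step, rightConfig, glue_right]

theorem step_leftConfig_left (h : M.δ q (l i) = some (q', a, .left)) :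
    M.step (leftConfig b q l r i) = some (leftConfig b q' (Function.update l i a) r (i + 1)) := by
  simp only [step, leftConfig, glue_left, h, Option.map_some, update_glue_left]
  congr 2
  push_cast
  ring

theorem step_leftConfig_right (h : M.δ q (l (i + 1)) = some (q', a, .right)) :
    M.step (leftConfig b q l r (i + 1)) =
      some (leftConfig b q' (Function.update l (i + 1) a) r i) := by
  simp only [step, leftConfig, glue_left, h, Option.map_some, update_glue_left]
  congr 2
  push_cast
  ring

theorem step_leftConfig_exit (h : M.δ q (l 0) = some (q', a, .right)) :
    M.step (leftConfig b q l r 0) = some (rightConfig b q' (Function.update l 0 a) r 0) := by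
  simp only [step, leftConfig, rightConfig, glue_left, h, Option.map_some, update_glue_left]
  congr 2
  push_cast
  ring

theorem step_rightConfig_right (h : M.δ q (r i) = some (q', a, .right)) :
    M.step (rightConfig b q l r i) = some (rightConfig b q' l (Function.update r i a) (i + 1)) := by
  simp only [step, rightConfig, glue_right, h, Option.map_some, update_glue_right]
  congr 2
  push_cast
  ring

theorem step_rightConfig_left (h : M.δ q (r (i + 1)) = some (q', a, .left)) :
    M.step (rightConfig b q l r (i + 1)) =
      some (rightConfig b q' l (Function.update r (i + 1) a) i) := by
  simp only [step, rightConfig, glue_right, h, Option.map_some, update_glue_right]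
  congr 2
  push_cast
  ring

theorem step_rightConfig_exit (h : M.δ q (r 0) = some (q', a, .left)) :
    M.step (rightConfig b q l r 0) = some (leftConfig b q' l (Function.update r 0 a) 0) := by
  simp only [step, leftConfig, rightConfig, glue_right, h, Option.map_some, update_glue_right]
  congr 2
  push_cast
  ring

end OneTapeTM

namespace OneTapeTM

variable {α Q Γ : Type*}

/-! ### Runs inside the left half tape -/

/-- The run that starts in the state `q` at distance `i` from the boundary in the left half tape `l`
has the given outcome: `none` if it halts in a final state without leaving the half tape, and
`some (q', l')` if it leaves the half tape, with content `l'`, through the boundary in the state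
`q'`. A run that halts in a nonfinal state or that stays in the half tape forever has no
outcome. -/
inductive LeftRun (M : OneTapeTM α Q Γ) :
    Q → (ℕ → Γ) → ℕ → Option (Q × (ℕ → Γ)) → Prop
  | accept {q l i} : M.δ q (l i) = none → q ∈ M.F → LeftRun M q l i none
  | left {q l i q' a o} : M.δ q (l i) = some (q', a, .left) →
      LeftRun M q' (Function.update l i a) (i + 1) o → LeftRun M q l i o
  | right {q l i q' a o} : M.δ q (l (i + 1)) = some (q', a, .right) →
      LeftRun M q' (Function.update l (i + 1) a) i o → LeftRun M q l (i + 1) o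
  | exit {q l q' a} : M.δ q (l 0) = some (q', a, .right) →
      LeftRun M q l 0 (some (q', Function.update l 0 a))

theorem LeftRun.unique {M : OneTapeTM α Q Γ} {q l i o o'} (h : M.LeftRun q l i o)
    (h' : M.LeftRun q l i o') : o = o' := by
  induction h with
  | accept h₁ _ => cases h' <;> simp_all
  | left h₁ _ ih => cases h' <;> simp_all
  | right h₁ _ ih => cases h' <;> simp_all
  | exit h₁ => cases h' <;> simp_all

theorem LeftRun.acceptsFrom {M : OneTapeTM α Q Γ} {q l i} (h : M.LeftRun q l i none) (b : ℤ)
    (r : ℕ → Γ) : M.AcceptsFrom (leftConfig b q l r i) := by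
  generalize ho : (none : Option (Q × (ℕ → Γ))) = o at h
  induction h with
  | accept h₁ hF => exact .of_halting ((M.isHalting_leftConfig b _ r).2 h₁) hF
  | left h₁ _ ih => exact .head (M.step_leftConfig_left b _ r h₁) (ih ho)
  | right h₁ _ ih => exact .head (M.step_leftConfig_right b _ r h₁) (ih ho)
  | exit h₁ => cases ho

theorem LeftRun.acceptsFrom_of_exit {M : OneTapeTM α Q Γ} {q l i q' l'}
    (h : M.LeftRun q l i (some (q', l'))) {b : ℤ} {r : ℕ → Γ}
    (hr : M.AcceptsFrom (rightConfig b q' l' r 0)) : M.AcceptsFrom (leftConfig b q l r i) := by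
  generalize ho : some (q', l') = o at h
  induction h with
  | accept h₁ hF => cases ho
  | left h₁ _ ih => exact .head (M.step_leftConfig_left b _ r h₁) (ih ho)
  | right h₁ _ ih => exact .head (M.step_leftConfig_right b _ r h₁) (ih ho)
  | exit h₁ =>
    cases ho
    exact .head (M.step_leftConfig_exit b _ r h₁) hr

/-- An accepting computation that starts in the left half tape accepts there, or leaves it and then
accepts in fewer steps. -/
theorem AcceptsIn.exists_leftRun {M : OneTapeTM α Q Γ} {t b q l r i}
    (h : M.AcceptsIn t (leftConfig b q l r i)) :
    M.LeftRun q l i none ∨ ∃ q' l', M.LeftRun q l i (some (q', l')) ∧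
      ∃ s < t, M.AcceptsIn s (rightConfig b q' l' r 0) := by
  induction t generalizing q l i with
  | zero =>
    rw [acceptsIn_zero, isHalting_leftConfig] at h
    exact .inl (.accept h.1 h.2)
  | succ t ih =>
    obtain ⟨c, hc, h⟩ := acceptsIn_succ.1 h
    rcases hδ : M.δ q (l i) with _ | ⟨q', a, d⟩
    · rw [(M.isHalting_leftConfig b l r).2 hδ] at hc
      cases hc
    · cases d with
      | left =>
        rw [M.step_leftConfig_left b l r hδ] at hc
        cases hc
        rcases ih h with h | ⟨p, l', h, s, hs, h'⟩
        · exact .inl (.left hδ h)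
        · exact .inr ⟨p, l', .left hδ h, s, by omega, h'⟩
      | right =>
        cases i with
        | zero =>
          rw [M.step_leftConfig_exit b l r hδ] at hc
          cases hc
          exact .inr ⟨_, _, .exit hδ, t, by omega, h⟩
        | succ i =>
          rw [M.step_leftConfig_right b l r hδ] at hc
          cases hc
          rcases ih h with h | ⟨p, l', h, s, hs, h'⟩
          · exact .inl (.right hδ h)
          · exact .inr ⟨p, l', .right hδ h, s, by omega, h'⟩

/-- Rewriting a symbol of `G` yields a symbol of `G` with a strictly smaller weight. -/
def Decreases (M : OneTapeTM α Q Γ) (G : Set Γ) (wt : Γ → ℕ) : Prop :=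
  ∀ p s q t d, s ∈ G → M.δ p s = some (q, t, d) → t ∈ G ∧ wt t < wt s

/-- A run in the left half tape does not increase the weight of the cell at the boundary. -/
theorem LeftRun.weight_le {M : OneTapeTM α Q Γ} {G : Set Γ} {wt : Γ → ℕ} (hG : M.Decreases G wt)
    {q l i q' l'} (h : M.LeftRun q l i (some (q', l'))) (hl : l 0 ∈ G) :
    l' 0 ∈ G ∧ wt (l' 0) ≤ wt (l 0) := by
  have key : ∀ {q : Q} {l : ℕ → Γ} {i q' a d}, l 0 ∈ G → M.δ q (l i) = some (q', a, d) →
      Function.update l i a 0 ∈ G ∧ wt (Function.update l i a 0) ≤ wt (l 0) := by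
    intro q l i q' a d hl h
    cases i with
    | zero =>
      have := hG _ _ _ _ _ hl h
      simpa using ⟨this.1, this.2.le⟩
    | succ i => simpa using hl
  generalize ho : some (q', l') = o at h
  induction h with
  | accept h₁ hF => cases ho
  | left h₁ _ ih =>
    have h₂ := key hl h₁
    have h₃ := ih h₂.1 ho
    exact ⟨h₃.1, h₃.2.trans h₂.2⟩
  | right h₁ _ ih =>
    have h₂ := key hl h₁
    have h₃ := ih h₂.1 ho
    exact ⟨h₃.1, h₃.2.trans h₂.2⟩
  | exit h₁ =>
    cases ho
    exact key hl h₁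

/-- A run that enters the left half tape through the boundary visits the cell there, so that the
weight of this cell decreases. -/
theorem LeftRun.weight_lt {M : OneTapeTM α Q Γ} {G : Set Γ} {wt : Γ → ℕ} (hG : M.Decreases G wt)
    {q l q' l'} (h : M.LeftRun q l 0 (some (q', l'))) (hl : l 0 ∈ G) :
    l' 0 ∈ G ∧ wt (l' 0) < wt (l 0) := by
  cases h with
  | left h₁ h =>
    have h₂ := hG _ _ _ _ _ hl h₁
    have h₃ := h.weight_le hG (by simpa using h₂.1)
    simp only [Function.update_self] at h₃
    exact ⟨h₃.1, h₃.2.trans_lt h₂.2⟩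
  | exit h₁ =>
    have h₂ := hG _ _ _ _ _ hl h₁
    simpa using h₂

/-- During `k` entries through the boundary, the half tape `m` reproduces the behaviour of `l`: an
accepting run is matched by an accepting run, an exit by an exit in the same state, after which `m`
continues to reproduce `l` during `k - 1` entries. -/
def Simulates (M : OneTapeTM α Q Γ) : ℕ → (ℕ → Γ) → (ℕ → Γ) → Prop
  | 0, _, _ => True
  | k + 1, l, m => ∀ q, (M.LeftRun q l 0 none → M.LeftRun q m 0 none) ∧
      ∀ q' l', M.LeftRun q l 0 (some (q', l')) →
        ∃ m', M.LeftRun q m 0 (some (q', m')) ∧ Simulates M k l' m'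

/-- If the number of simulated entries exceeds the weight of the cell at the boundary, the simulation
never breaks off, since each entry decreases this weight. -/
theorem Simulates.acceptsFrom {M : OneTapeTM α Q Γ} {G : Set Γ} {wt : Γ → ℕ}
    (hG : M.Decreases G wt) {t k : ℕ} {l m : ℕ → Γ} (hs : M.Simulates k l m) (hl : l 0 ∈ G)
    (hk : wt (l 0) < k) {b b' : ℤ} {q r i} (h : M.AcceptsIn t (rightConfig b q l r i)) :
    M.AcceptsFrom (rightConfig b' q m r i) := by
  induction t using Nat.strong_induction_on generalizing k l m q r i with
  | _ t ih =>
    cases t with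
    | zero =>
      rw [acceptsIn_zero, isHalting_rightConfig] at h
      exact .of_halting ((M.isHalting_rightConfig b' m r).2 h.1) h.2
    | succ t =>
      obtain ⟨c, hc, h⟩ := acceptsIn_succ.1 h
      rcases hδ : M.δ q (r i) with _ | ⟨q', a, d⟩
      · rw [(M.isHalting_rightConfig b l r).2 hδ] at hc
        cases hc
      · cases d with
        | right =>
          rw [M.step_rightConfig_right b l r hδ] at hc
          cases hc
          exact .head (M.step_rightConfig_right b' m r hδ) (ih t (by omega) hs hl hk h)
        | left =>
          cases i with
          | succ i =>
            rw [M.step_rightConfig_left b l r hδ] at hc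
            cases hc
            exact .head (M.step_rightConfig_left b' m r hδ) (ih t (by omega) hs hl hk h)
          | zero =>
            rw [M.step_rightConfig_exit b l r hδ] at hc
            cases hc
            refine .head (M.step_rightConfig_exit b' m r hδ) ?_
            obtain ⟨k, rfl⟩ : ∃ k', k = k' + 1 := ⟨k - 1, by omega⟩
            rcases h.exists_leftRun with h | ⟨p, l', h, s, hst, h'⟩
            · exact ((hs q').1 h).acceptsFrom b' _
            · obtain ⟨m', hm, hs'⟩ := (hs q').2 p l' h
              obtain ⟨hl', hw⟩ := h.weight_lt hG hl
              exact hm.acceptsFrom_of_exit (ih s (by omega) hs' hl' (by omega) h')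

open Classical in
/-- The outcome of a run in the left half tape, `none` if it has no outcome. -/
noncomputable def outcome (M : OneTapeTM α Q Γ) (q : Q) (l : ℕ → Γ) (i : ℕ) :
    Option (Option (Q × (ℕ → Γ))) :=
  if h : ∃ o, M.LeftRun q l i o then some h.choose else none

theorem outcome_eq_some {M : OneTapeTM α Q Γ} {q l i o} :
    M.outcome q l i = some o ↔ M.LeftRun q l i o := by
  unfold outcome
  split_ifs with h
  · rw [Option.some_inj]
    exact ⟨fun e => e ▸ h.choose_spec, fun h' => h.choose_spec.unique h'⟩
  · simpa using fun h' => h ⟨o, h'⟩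

/-- What remains of the outcome of a run if the half tapes are only known up to the classification
`f`. -/
noncomputable def signature {β : Type*} (M : OneTapeTM α Q Γ) (f : (ℕ → Γ) → β) (q : Q) (l : ℕ → Γ)
    (i : ℕ) : Option (Option (Q × β)) :=
  (M.outcome q l i).map (Option.map (Prod.map id f))

theorem LeftRun.of_signature_eq_none {β : Type*} {M : OneTapeTM α Q Γ} {f : (ℕ → Γ) → β} {q l m i j}
    (he : M.signature f q l i = M.signature f q m j) (h : M.LeftRun q l i none) :
    M.LeftRun q m j none := by
  rw [← outcome_eq_some] at h ⊢
  rw [signature, signature, h] at he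
  rcases hm : M.outcome q m j with _ | _ | p <;> simp_all

theorem LeftRun.of_signature_eq_some {β : Type*} {M : OneTapeTM α Q Γ} {f : (ℕ → Γ) → β}
    {q l m i j q' l'} (he : M.signature f q l i = M.signature f q m j)
    (h : M.LeftRun q l i (some (q', l'))) :
    ∃ m', M.LeftRun q m j (some (q', m')) ∧ f l' = f m' := by
  simp only [← outcome_eq_some] at h ⊢
  rw [signature, signature, h] at he
  rcases hm : M.outcome q m j with _ | _ | ⟨p, m'⟩
  · simp_all
  · simp_all
  · refine ⟨m', ?_⟩
    simp_all

/-- An upper bound for the number of behaviours of a half tape during `k` entries, for a machine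
with `s` states. -/
def behaviours (s : ℕ) : ℕ → ℕ
  | 0 => 1
  | k + 1 => (s * behaviours s k + 2) ^ s

/-- The classification records, for each state in which the half tape is entered, the outcome of the
run together with the class, for one entry less, of the half tape that is left behind. -/
theorem exists_classification [Fintype Q] (M : OneTapeTM α Q Γ) (k : ℕ) :
    ∃ f : (ℕ → Γ) → Fin (behaviours (Fintype.card Q) k),
      ∀ l m, f l = f m → M.Simulates k l m := by
  classical
  induction k with
  | zero => exact ⟨fun _ => ⟨0, Nat.one_pos⟩, fun _ _ _ => trivial⟩
  | succ k ih =>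
    obtain ⟨f, hf⟩ := ih
    have hcard : Fintype.card (Q → Option (Option (Q × Fin (behaviours (Fintype.card Q) k)))) =
        behaviours (Fintype.card Q) (k + 1) := by
      simp [behaviours]
    refine ⟨fun l => Fintype.equivFinOfCardEq hcard fun q => M.signature f q l 0,
      fun l m h q => ?_⟩
    have hq : M.signature f q l 0 = M.signature f q m 0 :=
      congrFun ((Fintype.equivFinOfCardEq hcard).injective h) q
    refine ⟨LeftRun.of_signature_eq_none hq, fun q' l' h' => ?_⟩
    obtain ⟨m', hm, he⟩ := h'.of_signature_eq_some hq
    exact ⟨m', hm, hf _ _ he⟩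

/-! ### Left quotients -/

/-- The language of the words that are accepted when they are written between `pre` and `post` and
the head starts on the leftmost symbol. -/
def languageBetween (M : OneTapeTM α Q Γ) (pre post : List Γ) : Language α :=
  {w | M.AcceptsFrom ⟨M.q₀, tapeOfList M.blank (pre ++ w.map M.inp ++ post), 0⟩}

/-- The left half tape that holds the list `x`. -/
def leftHalf (M : OneTapeTM α Q Γ) (x : List Γ) (i : ℕ) : Γ := x.reverse.getD i M.blank

theorem append_mem_languageBetween {M : OneTapeTM α Q Γ} {pre post : List Γ} {u v : List α}
    (hu : u ≠ []) :
    u ++ v ∈ M.languageBetween pre post ↔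
      M.AcceptsFrom (leftConfig (pre ++ u.map M.inp).length M.q₀ (M.leftHalf (pre ++ u.map M.inp))
        (fun i => (v.map M.inp ++ post).getD i M.blank) ((pre ++ u.map M.inp).length - 1)) := by
  have h₁ : 1 ≤ (pre ++ u.map M.inp).length := by
    have := List.length_pos_iff.2 hu
    simp; omega
  have h₂ : pre ++ (u ++ v).map M.inp ++ post = (pre ++ u.map M.inp) ++ (v.map M.inp ++ post) := by
    simp
  have h₃ : ((pre ++ u.map M.inp).length : ℤ) - 1 - ((pre ++ u.map M.inp).length - 1 : ℕ) = 0 := by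
    omega
  unfold languageBetween leftConfig leftHalf
  rw [h₃, ← tapeOfList_append, ← h₂]
  rfl

theorem LeftRun.leftHalf_weight {M : OneTapeTM α Q Γ} {G : Set Γ} {wt : Γ → ℕ}
    (hG : M.Decreases G wt) (hinp : ∀ a, M.inp a ∈ G) {pre : List Γ} {u : List α} (hu : u ≠ [])
    {q i q' l'} (h : M.LeftRun q (M.leftHalf (pre ++ u.map M.inp)) i (some (q', l'))) :
    l' 0 ∈ G := by
  refine (h.weight_le hG ?_).1
  obtain ⟨u, a, rfl⟩ := List.eq_nil_or_concat u |>.resolve_left hu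
  simpa [leftHalf] using hinp a

/-- Prefixes with the same signature admit the same continuations. The last cell of the prefix holds
a symbol of `G` whose weight is less than `k`, so the simulation of `k` entries is enough. -/
theorem languageBetween_of_signature_eq {M : OneTapeTM α Q Γ} {G : Set Γ} {wt : Γ → ℕ} {k : ℕ}
    (hG : M.Decreases G wt) (hinp : ∀ a, M.inp a ∈ G) (hk : ∀ s, wt s < k)
    {β : Type*} {f : (ℕ → Γ) → β} (hf : ∀ l m, f l = f m → M.Simulates k l m)
    {pre post : List Γ} {u v : List α} (hu : u ≠ []) (hv : v ≠ [])
    (he : M.signature f M.q₀ (M.leftHalf (pre ++ u.map M.inp)) ((pre ++ u.map M.inp).length - 1) =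
      M.signature f M.q₀ (M.leftHalf (pre ++ v.map M.inp)) ((pre ++ v.map M.inp).length - 1))
    {z : List α} (h : u ++ z ∈ M.languageBetween pre post) :
    v ++ z ∈ M.languageBetween pre post := by
  rw [append_mem_languageBetween hu] at h
  rw [append_mem_languageBetween hv]
  obtain ⟨t, ht⟩ := acceptsFrom_iff_exists_acceptsIn.1 h
  rcases ht.exists_leftRun with h | ⟨q', l', h, s, -, h'⟩
  · exact (h.of_signature_eq_none he).acceptsFrom _ _
  · obtain ⟨m', hm, hlm⟩ := h.of_signature_eq_some he
    exact hm.acceptsFrom_of_exit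
      ((hf _ _ hlm).acceptsFrom hG (h.leftHalf_weight hG hinp hu) (hk _) h')

/-- There is one left quotient by the empty word; the left quotient by a nonempty word `u` depends
only on the signature of the first run in the part of the tape that holds `u`. -/
theorem exists_dfa_languageBetween {α Q Γ : Type*} [Fintype Q] {M : OneTapeTM α Q Γ} {G : Set Γ}
    {wt : Γ → ℕ} {k : ℕ}
    (hG : M.Decreases G wt) (hinp : ∀ a, M.inp a ∈ G) (hk : ∀ s, wt s < k) (pre post : List Γ) :
    ∃ (n : ℕ) (A : DFA α (Fin n)), A.accepts = M.languageBetween pre post ∧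
      n ≤ Fintype.card Q * behaviours (Fintype.card Q) k + 3 := by
  classical
  obtain ⟨f, hf⟩ := M.exists_classification k
  set L := M.languageBetween pre post with hL
  let key : List α → Option (Option (Option (Q × Fin (behaviours (Fintype.card Q) k)))) := fun u =>
    if u = [] then none else some (M.signature f M.q₀ (M.leftHalf (pre ++ u.map M.inp))
      ((pre ++ u.map M.inp).length - 1))
  have hkey : ∀ u v, key u = key v → L.leftQuotient u = L.leftQuotient v := by
    intro u v h
    by_cases hu : u = [] <;> by_cases hv : v = [] <;> simp only [key, hu, hv, if_true, if_false] at h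
    · rw [hu, hv]
    · cases h
    · cases h
    · rw [Option.some_inj] at h
      ext z
      simp only [Language.mem_leftQuotient]
      exact ⟨languageBetween_of_signature_eq hG hinp hk hf hu hv h,
        languageBetween_of_signature_eq hG hinp hk hf hv hu h.symm⟩
  have hinj : Function.Injective fun z : Set.range L.leftQuotient => key z.2.choose := by
    intro y z h
    have := hkey _ _ h
    rw [y.2.choose_spec, z.2.choose_spec] at this
    exact Subtype.ext this
  have : Finite (Set.range L.leftQuotient) := Finite.of_injective _ hinj
  let _ := Fintype.ofFinite (Set.range L.leftQuotient)
  refine ⟨Fintype.card (Set.range L.leftQuotient), DFA.reindex (Fintype.equivFin _) L.toDFA, ?_, ?_⟩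
  · rw [DFA.accepts_reindex, Language.accepts_toDFA]
  · refine (Fintype.card_le_of_injective _ hinj).trans ?_
    simp

end OneTapeTM

/-! ### The double exponential upper bound -/

namespace OneTapeTM

variable {α Q Γ : Type*}

/-- With `L = ⌊log₂ (s + 1)⌋`, the recursion `N ↦ (s N + 2) ^ s` for `N = 2 ^ a` becomes
`a ↦ s (a + L + 1)` at the level of exponents, which multiplies `a + L + 1` by at most
`s + 1 ≤ 2 ^ (L + 1)`. -/
theorem exists_behaviours_le (s k : ℕ) :
    ∃ a, behaviours s k ≤ 2 ^ a ∧
      a + (Nat.log 2 (s + 1) + 1) ≤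
        (Nat.log 2 (s + 1) + 1) * 2 ^ ((Nat.log 2 (s + 1) + 1) * k) := by
  have hs : s + 1 < 2 ^ (Nat.log 2 (s + 1) + 1) := Nat.lt_pow_succ_log_self (by norm_num) _
  set L := Nat.log 2 (s + 1) + 1
  induction k with
  | zero => exact ⟨0, by simp [behaviours], by simp⟩
  | succ k ih =>
    obtain ⟨a, ha, hL⟩ := ih
    refine ⟨s * (a + L), ?_, ?_⟩
    · have h₁ : 1 ≤ 2 ^ a := Nat.one_le_two_pow
      have h₂ : s * behaviours s k + 2 ≤ 2 ^ (a + L) :=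
        calc s * behaviours s k + 2 ≤ s * 2 ^ a + 2 * 2 ^ a := by gcongr; omega
          _ = 2 ^ a * (s + 2) := by ring
          _ ≤ 2 ^ a * 2 ^ L := Nat.mul_le_mul_left _ hs
          _ = 2 ^ (a + L) := (pow_add 2 a L).symm
      calc behaviours s (k + 1) ≤ (2 ^ (a + L)) ^ s := Nat.pow_le_pow_left h₂ s
        _ = 2 ^ (s * (a + L)) := by rw [← pow_mul, mul_comm]
    · calc s * (a + L) + L ≤ (s + 1) * (a + L) := by nlinarith
        _ ≤ 2 ^ L * (L * 2 ^ (L * k)) := by gcongr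
        _ = L * 2 ^ (L * (k + 1)) := by rw [mul_add, pow_add, mul_one]; ring

theorem behaviours_bound {s k : ℕ} (hs : 1 ≤ s) (hk : 1 ≤ k) :
    s * behaviours s k + 3 ≤ 2 ^ 2 ^ (4 * (k * Nat.log 2 (s + 1))) := by
  obtain ⟨a, ha, hL⟩ := exists_behaviours_le s k
  have hl : 1 ≤ Nat.log 2 (s + 1) := Nat.log_pos (by norm_num) (by omega)
  have hs : s + 1 < 2 ^ (Nat.log 2 (s + 1) + 1) := Nat.lt_pow_succ_log_self (by norm_num) _
  set l := Nat.log 2 (s + 1)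
  have h₁ : 1 ≤ 2 ^ a := Nat.one_le_two_pow
  have h₂ : 1 ≤ 2 ^ ((l + 1) * k) := Nat.one_le_two_pow
  have h₃ : l + 2 ≤ 2 ^ (l + 1) := Nat.lt_two_pow_self
  calc s * behaviours s k + 3 ≤ s * 2 ^ a + 3 * 2 ^ a := by gcongr; omega
    _ = 2 ^ a * (s + 3) := by ring
    _ ≤ 2 ^ a * (2 ^ (l + 1) * 2) := by gcongr; omega
    _ = 2 ^ (a + (l + 1) + 1) := by ring
    _ ≤ 2 ^ ((l + 1) * 2 ^ ((l + 1) * k) + 1 * 2 ^ ((l + 1) * k)) := by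
      apply Nat.pow_le_pow_right (by norm_num)
      omega
    _ = 2 ^ ((l + 2) * 2 ^ ((l + 1) * k)) := by ring
    _ ≤ 2 ^ (2 ^ (l + 1) * 2 ^ ((l + 1) * k)) := by
      apply Nat.pow_le_pow_right (by norm_num)
      gcongr
    _ = 2 ^ 2 ^ ((l + 1) * (k + 1)) := by rw [← pow_add]; ring
    _ ≤ 2 ^ 2 ^ ((2 * l) * (2 * k)) := by
      apply Nat.pow_le_pow_right (by norm_num)
      apply Nat.pow_le_pow_right (by norm_num)
      apply Nat.mul_le_mul <;> omega
    _ = 2 ^ 2 ^ (4 * (k * l)) := by ring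

theorem card_mul_log_le_size [Fintype Q] [Fintype Γ] (M : OneTapeTM α Q Γ) :
    Fintype.card Γ * Nat.log 2 (Fintype.card Q + 1) ≤ M.size ∧ Fintype.card Γ ≤ M.size := by
  have hQ : 1 ≤ Fintype.card Q := Fintype.card_pos_iff.2 ⟨M.q₀⟩
  have hΓ : 1 ≤ Fintype.card Γ := Fintype.card_pos_iff.2 ⟨M.blank⟩
  unfold size
  set s := Fintype.card Q
  set g := Fintype.card Γ
  have hl : Nat.log 2 (s + 1) ≤ s :=
    Nat.lt_succ_iff.1 (Nat.log_lt_of_lt_pow (by omega) Nat.lt_two_pow_self)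
  have hc : 1 ≤ Nat.clog 2 (2 * s * g + 1) := Nat.clog_pos (by norm_num) (by nlinarith)
  have h : g * s ≤ s * g * Nat.clog 2 (2 * s * g + 1) + s :=
    calc g * s = s * g * 1 := by ring
      _ ≤ s * g * Nat.clog 2 (2 * s * g + 1) := Nat.mul_le_mul_left _ hc
      _ ≤ _ := Nat.le_add_right _ _
  exact ⟨(Nat.mul_le_mul_left g hl).trans h, (Nat.le_mul_of_pos_right g hQ).trans h⟩

theorem tableSize_le {α : Type*} [Fintype α] {n m x : ℕ} (A : DFA α (Fin n))
    (hα : Fintype.card α ≤ m) (hm : 1 ≤ m) (hx : x ≤ 4 * m) (hn : n ≤ 2 ^ 2 ^ x) :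
    A.tableSize ≤ 2 ^ 2 ^ (8 * m) := by
  have h₁ : Nat.clog 2 (n + 1) ≤ 2 ^ x + 1 := by
    apply Nat.clog_le_of_le_pow
    have : 1 ≤ 2 ^ 2 ^ x := Nat.one_le_two_pow
    rw [pow_succ]
    omega
  have h₂ : 2 ^ x + 1 ≤ 2 ^ 2 ^ x := Nat.lt_two_pow_self
  have h₃ : m + 1 ≤ 2 ^ m := Nat.lt_two_pow_self
  have h₄ : m + 2 ≤ 2 ^ (m + 1) := Nat.lt_two_pow_self
  have h₅ : 1 ≤ 2 ^ 2 ^ x := Nat.one_le_two_pow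
  have h₆ : 1 ≤ 2 ^ x := Nat.one_le_two_pow
  unfold DFA.tableSize
  rw [Fintype.card_fin]
  calc Fintype.card α * n * Nat.clog 2 (n + 1) + n
      ≤ m * 2 ^ 2 ^ x * 2 ^ 2 ^ x + 2 ^ 2 ^ x * 2 ^ 2 ^ x := by
        gcongr
        · exact h₁.trans h₂
        · exact hn.trans (Nat.le_mul_of_pos_right _ h₅)
    _ = (m + 1) * 2 ^ (2 ^ x * 2) := by rw [pow_mul]; ring
    _ ≤ 2 ^ m * 2 ^ (2 ^ x * 2) := by gcongr
    _ = 2 ^ (m + 2 ^ x * 2) := by rw [pow_add]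
    _ ≤ 2 ^ (2 ^ x * 2 ^ (m + 1)) := by
      apply Nat.pow_le_pow_right (by norm_num)
      calc m + 2 ^ x * 2 ≤ 2 ^ x * m + 2 ^ x * 2 := by gcongr; exact Nat.le_mul_of_pos_left _ h₆
        _ = 2 ^ x * (m + 2) := by ring
        _ ≤ 2 ^ x * 2 ^ (m + 1) := by gcongr
    _ = 2 ^ 2 ^ (x + (m + 1)) := by rw [← pow_add]
    _ ≤ 2 ^ 2 ^ (8 * m) := by
      apply Nat.pow_le_pow_right (by norm_num)
      apply Nat.pow_le_pow_right (by norm_num)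
      omega

theorem exists_small_dfa_languageBetween {α Q Γ : Type*} [Fintype α] [Fintype Q] [Fintype Γ]
    {M : OneTapeTM α Q Γ} {G : Set Γ} {wt : Γ → ℕ} (hG : M.Decreases G wt)
    (hinp : ∀ a, M.inp a ∈ G) (hwt : ∀ s, wt s < Fintype.card Γ) (pre post : List Γ) :
    ∃ (k : ℕ) (A : DFA α (Fin k)), A.accepts = M.languageBetween pre post ∧
      k ≤ 2 ^ 2 ^ (8 * (Fintype.card Γ * Nat.log 2 (Fintype.card Q + 1))) ∧
      A.tableSize ≤ 2 ^ 2 ^ (8 * M.size) := by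
  obtain ⟨k, A, hA, hk⟩ := exists_dfa_languageBetween hG hinp hwt pre post
  have hQ : 1 ≤ Fintype.card Q := Fintype.card_pos_iff.2 ⟨M.q₀⟩
  have hΓ : 1 ≤ Fintype.card Γ := Fintype.card_pos_iff.2 ⟨M.blank⟩
  have hk' := hk.trans (behaviours_bound hQ hΓ)
  obtain ⟨h₁, h₂⟩ := M.card_mul_log_le_size
  refine ⟨k, A, hA, hk'.trans ?_, tableSize_le A
    ((Fintype.card_le_of_embedding M.inp).trans h₂) (hΓ.trans h₂)
    (Nat.mul_le_mul_left 4 h₁) hk'⟩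
  apply Nat.pow_le_pow_right (by norm_num)
  apply Nat.pow_le_pow_right (by norm_num)
  omega

/-- The weight of a symbol is the number of smaller symbols. -/
theorem exists_small_dfa {α Q Γ : Type*} [Fintype α] [Fintype Q] [Fintype Γ]
    {M : OneTapeTM α Q Γ} (hM : M.WeightReducing) :
    ∃ (k : ℕ) (A : DFA α (Fin k)), A.accepts = M.language ∧
      k ≤ 2 ^ 2 ^ (8 * (Fintype.card Γ * Nat.log 2 (Fintype.card Q + 1))) ∧
      A.tableSize ≤ 2 ^ 2 ^ (8 * M.size) := by
  classical
  obtain ⟨_, h⟩ := hM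
  have hd : M.Decreases Set.univ fun s => (Finset.univ.filter (· < s)).card := by
    refine fun p s q t d _ hδ => ⟨trivial, Finset.card_lt_card ?_⟩
    have hts := h p s q t d hδ
    refine (Finset.ssubset_iff_of_subset fun r hr => ?_).2 ⟨t, by simpa using hts, by simp⟩
    simp only [Finset.mem_filter, Finset.mem_univ, true_and] at hr ⊢
    exact hr.trans hts
  obtain ⟨k, A, hA, hk⟩ := exists_small_dfa_languageBetween hd (fun _ => trivial)
    (fun s => Finset.card_lt_univ_of_notMem (x := s) (by simp)) [] []
  refine ⟨k, A, hA.trans ?_, hk⟩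
  simp [languageBetween, language, init]
  rfl

end OneTapeTM

/-- The last cell of a nonempty prefix of the input never holds an endmarker, so it does not matter
that endmarkers are rewritten by themselves. -/
theorem EndMarkedTM.exists_small_dfa {α Q Γ : Type*} [Fintype α] [Fintype Q] [Fintype Γ]
    {M : EndMarkedTM α Q Γ} (hM : M.IsWeightReducingHennie) :
    ∃ (k : ℕ) (A : DFA α (Fin k)), A.accepts = M.markedLanguage ∧
      k ≤ 2 ^ 2 ^ (8 * (Fintype.card Γ * Nat.log 2 (Fintype.card Q + 1))) ∧
      A.tableSize ≤ 2 ^ 2 ^ (8 * M.size) := by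
  classical
  obtain ⟨-, _, h⟩ := hM
  have hd : M.Decreases {s | s ≠ M.lend ∧ s ≠ M.rend} fun s =>
      (Finset.univ.filter fun t : {s : Γ // s ≠ M.lend ∧ s ≠ M.rend} =>
        ∃ hs : s ≠ M.lend ∧ s ≠ M.rend, t < ⟨s, hs⟩).card := by
    intro p s q t d hs hδ
    obtain ⟨ht, hts⟩ := h p ⟨s, hs⟩ q t d hδ
    refine ⟨ht, Finset.card_lt_card ?_⟩
    refine (Finset.ssubset_iff_of_subset fun r hr => ?_).2 ⟨⟨t, ht⟩, ?_, ?_⟩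
    · simp only [Finset.mem_filter, Finset.mem_univ, true_and] at hr ⊢
      obtain ⟨ht, hr⟩ := hr
      exact ⟨hs, hr.trans hts⟩
    · simpa using ⟨hs, hts⟩
    · simp
  obtain ⟨k, A, hA, hk⟩ := OneTapeTM.exists_small_dfa_languageBetween hd
    (fun a => ⟨M.inp_ne_lend a, M.inp_ne_rend a⟩)
    (fun s => (Finset.card_le_univ _).trans_lt
      (Fintype.card_subtype_lt (x := M.lend) (by simp))) [M.lend] [M.rend]
  refine ⟨k, A, hA.trans ?_, hk⟩
  simp [OneTapeTM.languageBetween, markedLanguage, initMarked]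
  rfl

/-! ### The block language and the lower bound -/

/-- The word `v₁ $ v₂ $ ⋯ $ v_k` with the given blocks. -/
def blockWord (bs : List (List Bool)) : List (Option Bool) :=
  List.intercalate [none] (bs.map (List.map some))

theorem blockWord_append_singleton (us : List (List Bool)) (v : List Bool) :
    blockWord (us ++ [v]) = us.flatMap (fun u => u.map some ++ [none]) ++ v.map some := by
  unfold blockWord
  induction us with
  | nil => simp
  | cons u us ih =>
    rw [List.cons_append, List.map_cons, List.intercalate_cons_of_ne_nil (by simp), ih]
    simp

theorem blockWord_injective {bs cs : List (List Bool)} (hb : bs ≠ []) (hc : cs ≠ [])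
    (h : blockWord bs = blockWord cs) : bs = cs := by
  have key : ∀ {ds : List (List Bool)}, ds ≠ [] →
      (blockWord ds).splitOn none = ds.map (List.map some) := by
    intro ds hd
    apply List.splitOn_intercalate
    · simp
    · simpa using hd
  have h' := key hb
  rw [h, key hc] at h'
  exact ((List.map_injective_iff.2 (List.map_injective_iff.2 (Option.some_injective _))) h').symm

theorem exists_blockWord (w : List (Option Bool)) : ∃ us v, w = blockWord (us ++ [v]) := by
  suffices h : ∃ b bs, w = blockWord (b :: bs) by
    obtain ⟨b, bs, rfl⟩ := h
    obtain ⟨us, v, h⟩ := List.eq_nil_or_concat (b :: bs) |>.resolve_left (by simp)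
    exact ⟨us, v, by rw [h, List.concat_eq_append]⟩
  induction w with
  | nil => exact ⟨[], [], rfl⟩
  | cons a w ih =>
    obtain ⟨b, bs, rfl⟩ := ih
    cases a with
    | none => exact ⟨[], b :: bs, by simp [blockWord]⟩
    | some a => exact ⟨a :: b, bs, by simp [blockWord]⟩

theorem blockWord_mem_blockLanguage {n : ℕ} {us : List (List Bool)} {v : List Bool} :
    blockWord (us ++ [v]) ∈ blockLanguage n ↔
      2 ≤ us.length ∧ v.length ≤ n ∧ (∀ u ∈ us, v.length ≤ u.length) ∧ v ∈ us := by
  constructor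
  · rintro ⟨us', v', h, h₁, h₂⟩
    have := blockWord_injective (by simp) (by simp) h
    obtain ⟨rfl, h₃⟩ := List.append_inj' this rfl
    obtain rfl : v = v' := by simpa using h₃
    exact ⟨by simp at h₁; omega, h₂⟩
  · rintro ⟨h₁, h₂⟩
    exact ⟨us, v, rfl, by simp; omega, h₂⟩

/-- A partial deterministic automaton is in at most one state after each word. -/
theorem NFA.IsPartialDFA.subsingleton_eval {α σ : Type*} {A : NFA α σ} (hA : A.IsPartialDFA)
    (w : List α) : (A.eval w).Subsingleton := by
  obtain ⟨⟨q₀, h₀⟩, h⟩ := hA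
  induction w using List.reverseRecOn with
  | nil => simp [h₀]
  | append_singleton w a ih =>
    rw [NFA.eval_append_singleton]
    intro s hs t ht
    rw [NFA.mem_stepSet] at hs ht
    obtain ⟨s', hs', hs⟩ := hs
    obtain ⟨t', ht', ht⟩ := ht
    rw [ih hs' ht'] at hs
    exact h _ _ hs ht

/-- If the automaton accepts an extension of each `f i`, and if the words `f i` have pairwise
different left quotients, then the words `f i` lead to different states. -/
theorem NFA.IsPartialDFA.card_le {α σ ι : Type*} [Fintype σ] [Fintype ι] {A : NFA α σ}
    (hA : A.IsPartialDFA) (f : ι → List α) (hlive : ∀ i, ∃ z, f i ++ z ∈ A.accepts)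
    (hf : ∀ i j, (∀ z, f i ++ z ∈ A.accepts ↔ f j ++ z ∈ A.accepts) → i = j) :
    Fintype.card ι ≤ Fintype.card σ := by
  have hmem : ∀ i, ∃ s, s ∈ A.eval (f i) := by
    intro i
    obtain ⟨z, s, -, hs⟩ := hlive i
    rw [NFA.eval, NFA.evalFrom_append] at hs
    by_contra! h
    have h' : A.eval (f i) = ∅ := Set.eq_empty_of_forall_notMem h
    rw [NFA.eval] at h'
    rw [h'] at hs
    have : ∀ z, A.evalFrom ∅ z = ∅ := by
      intro z
      induction z with
      | nil => rfl
      | cons a z ih => simpa using ih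
    simp [this] at hs
  choose g hg using hmem
  refine Fintype.card_le_of_injective g fun i j hij => hf i j fun z => ?_
  have hi : A.eval (f i) = A.eval (f j) := by
    rw [(hA.subsingleton_eval _).eq_singleton_of_mem (hg i),
      (hA.subsingleton_eval _).eq_singleton_of_mem (hg j), hij]
  rw [NFA.mem_accepts, NFA.mem_accepts, NFA.evalFrom_append, NFA.evalFrom_append]
  simp only [NFA.eval] at hi
  rw [hi]

/-- The blocks that encode a set of words of length `n`. The two blocks of length `n + 1` provide for
the number of blocks, and match none of these words. -/
noncomputable def codeBlocks {n : ℕ} (S : Finset (Fin n → Bool)) : List (List Bool) :=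
  List.replicate 2 (List.replicate (n + 1) true) ++ S.toList.map List.ofFn

theorem blockWord_codeBlocks_mem {n : ℕ} (S : Finset (Fin n → Bool)) (v : Fin n → Bool) :
    blockWord (codeBlocks S ++ [List.ofFn v]) ∈ blockLanguage n ↔ v ∈ S := by
  rw [blockWord_mem_blockLanguage]
  have h : List.ofFn v ≠ List.replicate (n + 1) true := by
    intro h
    simpa using congrArg List.length h
  constructor
  · rintro ⟨-, -, -, h'⟩
    simpa [codeBlocks, h, List.ofFn_injective.eq_iff] using h'
  · intro hv
    refine ⟨by simp [codeBlocks], by simp, fun u hu => ?_, ?_⟩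
    · simp only [codeBlocks, List.mem_append, List.mem_replicate, List.mem_map] at hu
      rcases hu with ⟨-, rfl⟩ | ⟨u, -, rfl⟩ <;> simp
    · simpa [codeBlocks, h, List.ofFn_injective.eq_iff] using hv

theorem blockWord_append_append (bs cs : List (List Bool)) (v : List Bool) :
    blockWord ((bs ++ [v]) ++ cs) =
      blockWord (bs ++ [v]) ++ cs.flatMap fun c => none :: c.map some := by
  induction cs using List.reverseRecOn with
  | nil => simp
  | append_singleton cs c ih =>
    obtain ⟨us, u, h⟩ := List.eq_nil_or_concat (bs ++ [v] ++ cs) |>.resolve_left (by simp)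
    rw [List.concat_eq_append] at h
    have h' : blockWord (us ++ [u] ++ [c]) = blockWord (us ++ [u]) ++ none :: c.map some := by
      simp only [blockWord_append_singleton]
      simp
    rw [← List.append_assoc, h, h', ← h, ih]
    simp

theorem two_pow_two_pow_le_card {n : ℕ} {σ : Type*} [Fintype σ] {A : NFA (Option Bool) σ}
    (hA : A.IsPartialDFA) (hL : A.accepts = blockLanguage n) : 2 ^ 2 ^ n ≤ Fintype.card σ := by
  have hword : ∀ (S : Finset (Fin n → Bool)) (cs : List (List Bool)),
      blockWord (codeBlocks S) ++ cs.flatMap (fun c => none :: c.map some) =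
        blockWord (codeBlocks S ++ cs) := by
    intro S cs
    obtain ⟨us, u, h⟩ := List.eq_nil_or_concat (codeBlocks S) |>.resolve_left (by simp [codeBlocks])
    rw [h, List.concat_eq_append, blockWord_append_append]
  have h := hA.card_le (fun S : Finset (Fin n → Bool) => blockWord (codeBlocks S)) ?_ ?_
  · simpa using h
  · intro S
    refine ⟨List.flatMap (fun c => none :: c.map some)
      (List.replicate 2 (List.replicate n true)), ?_⟩
    rw [hword, hL]
    have : codeBlocks S ++ List.replicate 2 (List.replicate n true) =
        (codeBlocks S ++ [List.replicate n true]) ++ [List.replicate n true] := by simp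
    rw [this, blockWord_mem_blockLanguage]
    refine ⟨by simp [codeBlocks], by simp, fun u hu => ?_, by simp⟩
    simp only [codeBlocks, List.mem_append, List.mem_replicate, List.mem_map,
      List.mem_singleton] at hu
    rcases hu with (⟨-, rfl⟩ | ⟨u, -, rfl⟩) | rfl <;> simp
  · intro S T h
    ext v
    have hv := h (List.flatMap (fun c => none :: c.map some) [List.ofFn v])
    rwa [hword, hword, hL, blockWord_codeBlocks_mem, blockWord_codeBlocks_mem] at hv

/-! ### The sweeping algorithm for the block language -/

namespace BlockMachine

/-- The payload of a cell: an input bit that has not been processed, a processed bit together with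
the information whether it agrees with the corresponding bit of the last block, or the separator
`$`. -/
inductive Payload
  | bit (b : Bool)
  | used (ok : Bool)
  | sep
  deriving DecidableEq, Fintype

/-- The states. In `forth` the head moves to the right without changing the payloads; all the other
states belong to sweeps from right to left. Such a sweep starts in `look`, in search of the first
unprocessed bit of the last block. If there is one, say `b`, the sweep compares it with the first
unprocessed bit of each of the other blocks: `found b` is used in the rest of the last block,
`seek b` in another block up to its first unprocessed bit, and `passed b` in the rest of that block.
Otherwise the sweep is the last one, in `check f a t`: the flag `f` tells whether one of the blocks
that have been read entirely equals the last block, `a` whether the current block may still be equal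
to it, and `t` whether at least two separators have been read. -/
inductive Phase
  | forth
  | look
  | found (b : Bool)
  | seek (b : Bool)
  | passed (b : Bool)
  | check (f a t : Bool)
  deriving DecidableEq, Fintype

open Payload Phase

/-- The action on a single cell in a sweep from right to left. -/
def sweepCell : Phase → Payload → Option (Phase × Payload)
  | forth, _ => none
  | look, used o => some (look, used o)
  | look, bit b => some (found b, used true)
  | look, sep => some (check false true false, sep)
  | found b, sep => some (seek b, sep)
  | found b, p => some (found b, p)
  | seek b, used o => some (seek b, used o)
  | seek b, bit c => some (passed b, used (b == c))
  | seek _, sep => none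
  | passed b, sep => some (seek b, sep)
  | passed b, p => some (passed b, p)
  | check f a t, used true => some (check f a t, used true)
  | check f a _, sep => some (check (f || a) true true, sep)
  | check f _ t, p => some (check f false t, p)

/-- A sweep from right to left. The list of the payloads is read from its head, hence it is the
reversal of the tape. -/
def sweep : Phase → List Payload → Option (Phase × List Payload)
  | q, [] => some (q, [])
  | q, p :: y => (sweepCell q p).bind fun r => (sweep r.1 y).map fun r' => (r'.1, r.2 :: r'.2)

/-- Whether the reversed tape `y` is accepted within `j` rounds, each of which consists of a sweep
to the right and a sweep to the left. -/
def verdict : ℕ → List Payload → Bool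
  | 0, _ => false
  | j + 1, y => match sweep look y with
    | some (passed _, y') => verdict j y'
    | some (check f a t, _) => (f || a) && t
    | _ => false

/-- The block `s` after `i` rounds, if the last block is `r`: the first `i` bits have been compared
with those of `r`. Blocks are read from right to left. -/
def block : ℕ → List Bool → List Bool → List Payload
  | 0, _, s => s.map bit
  | i + 1, b :: r, c :: s => used (b == c) :: block i r s
  | _ + 1, _, _ => []

/-- The reversed tape after `i` rounds, where `r` is the last block and `rs` is the list of the
other blocks, all of them read from right to left. -/
def blocks (i : ℕ) (r : List Bool) (rs : List (List Bool)) : List Payload :=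
  block i r r ++ rs.flatMap fun s => sep :: block i r s

theorem sweep_append (q : Phase) (x y : List Payload) :
    sweep q (x ++ y) =
      (sweep q x).bind fun r => (sweep r.1 y).map fun r' => (r'.1, r.2 ++ r'.2) := by
  induction x generalizing q with
  | nil => simp [sweep]
  | cons p x ih =>
    simp only [List.cons_append, sweep]
    rcases sweepCell q p with _ | ⟨q', p'⟩
    · rfl
    · simp only [Option.bind_some, ih]
      rcases sweep q' x with _ | ⟨q'', x'⟩
      · rfl
      · simp only [Option.bind_some, Option.map_some]
        rcases sweep q'' y with _ | ⟨q''', y'⟩ <;> rfl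

theorem sweep_length {q q' : Phase} {y y' : List Payload} (h : sweep q y = some (q', y')) :
    y'.length = y.length := by
  induction y generalizing q q' y' with
  | nil => simp_all [sweep]
  | cons p y ih =>
    simp only [sweep, Option.bind_eq_some_iff, Option.map_eq_some_iff] at h
    obtain ⟨⟨q₁, p₁⟩, -, ⟨q₂, y₂⟩, h₂, h₃⟩ := h
    cases h₃
    rw [List.length_cons, List.length_cons, ih h₂]

theorem sweep_bits {q : Phase} (hq : ∀ b, sweepCell q (bit b) = some (q, bit b)) (s : List Bool) :
    sweep q (s.map bit) = some (q, s.map bit) := by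
  induction s with
  | nil => rfl
  | cons b s ih => simp [sweep, hq, ih]

theorem sweep_look_block {i : ℕ} {r : List Bool} {b : Bool} (h : r[i]? = some b) :
    sweep look (block i r r) = some (found b, block (i + 1) r r) := by
  induction i generalizing r with
  | zero =>
    cases r with
    | nil => simp at h
    | cons c r =>
      obtain rfl : c = b := by simpa using h
      simp [block, sweep, sweepCell, sweep_bits (q := found c) fun _ => rfl]
  | succ i ih =>
    cases r with
    | nil => simp at h
    | cons c r =>
      rw [List.getElem?_cons_succ] at h
      simp [block, sweep, sweepCell, ih h]

theorem sweep_look_block_length (r : List Bool) :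
    sweep look (block r.length r r) = some (look, block r.length r r) := by
  induction r with
  | nil => rfl
  | cons c r ih => simp [block, sweep, sweepCell, ih]

theorem sweep_seek_block {i : ℕ} {r s : List Bool} {b : Bool} (h : r[i]? = some b)
    (hs : i < s.length) :
    sweep (seek b) (block i r s) = some (passed b, block (i + 1) r s) := by
  induction i generalizing r s with
  | zero =>
    cases r with
    | nil => simp at h
    | cons c r =>
      obtain rfl : c = b := by simpa using h
      cases s with
      | nil => simp at hs
      | cons d s => simp [block, sweep, sweepCell, sweep_bits (q := passed c) fun _ => rfl]
  | succ i ih =>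
    cases r with
    | nil => simp at h
    | cons c r =>
      rw [List.getElem?_cons_succ] at h
      cases s with
      | nil => simp at hs
      | cons d s => simp [block, sweep, sweepCell, ih h (by simpa using hs)]

/-- A block of length `i` has no unprocessed bit after `i` rounds. -/
theorem sweep_seek_block_length (b : Bool) (r s : List Bool) :
    sweep (seek b) (block s.length r s) = some (seek b, block s.length r s) := by
  induction s generalizing r with
  | nil => rfl
  | cons d s ih =>
    cases r with
    | nil => rfl
    | cons c r => simp [block, sweep, sweepCell, ih]

theorem sweep_check_block {r s : List Bool} (h : r.length ≤ s.length) (f a t : Bool) :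
    ∃ y, sweep (check f a t) (block r.length r s) = some (check f (a && decide (s = r)) t, y) := by
  induction r generalizing s a with
  | nil =>
    cases s with
    | nil => exact ⟨[], by simp [block, sweep]⟩
    | cons c s =>
      refine ⟨bit c :: s.map bit, ?_⟩
      simp [block, sweep, sweepCell, sweep_bits (q := check f false t) fun _ => rfl]
  | cons b r ih =>
    cases s with
    | nil => simp at h
    | cons c s =>
      by_cases hbc : b = c
      · subst hbc
        obtain ⟨y, hy⟩ := ih (s := s) (by simpa using h) a
        exact ⟨used true :: y, by simp [block, sweep, sweepCell, hy]⟩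
      · obtain ⟨y, hy⟩ := ih (s := s) (by simpa using h) false
        have hcb : ¬ c = b := fun h => hbc h.symm
        refine ⟨used false :: y, ?_⟩
        simp [block, sweep, sweepCell, hbc, hcb, hy]

theorem sweep_check_blocks {r : List Bool} {rs : List (List Bool)}
    (h : ∀ s ∈ rs, r.length ≤ s.length) (f a t : Bool) :
    ∃ f' a' t' y, sweep (check f a t) (rs.flatMap fun s => sep :: block r.length r s) =
      some (check f' a' t', y) ∧ (f' || a') = (f || a || decide (r ∈ rs)) ∧
        t' = (t || !rs.isEmpty) := by
  induction rs generalizing f a t with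
  | nil => exact ⟨f, a, t, [], by simp [sweep]⟩
  | cons s rs ih =>
    obtain ⟨y, hy⟩ := sweep_check_block (h s (by simp)) (f || a) true true
    obtain ⟨f', a', t', z, hz, h₁, h₂⟩ :=
      ih (fun s hs => h s (by simp [hs])) (f || a) (true && decide (s = r)) true
    refine ⟨f', a', t', sep :: (y ++ z), ?_, ?_, ?_⟩
    · simp only [List.flatMap_cons, List.cons_append, sweep, sweepCell, Option.bind_some,
        sweep_append, hy, hz, Option.map_some]
    · rw [h₁]
      simp [eq_comm (a := s), Bool.or_assoc]
    · simpa using h₂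

theorem verdict_check {r : List Bool} {rs : List (List Bool)}
    (h : ∀ s ∈ rs, r.length ≤ s.length) (j : ℕ) :
    verdict (j + 1) (blocks r.length r rs) = decide (2 ≤ rs.length ∧ r ∈ rs) := by
  cases rs with
  | nil => simp [verdict, blocks, sweep_look_block_length]
  | cons s rs =>
    obtain ⟨y, hy⟩ := sweep_check_block (h s (by simp)) false true false
    obtain ⟨f', a', t', z, hz, h₁, h₂⟩ := sweep_check_blocks (r := r) (rs := rs)
      (fun s hs => h s (by simp [hs])) false (true && decide (s = r)) false
    have hs : sweep look (blocks r.length r (s :: rs)) =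
        some (check f' a' t', block r.length r r ++ (sep :: (y ++ z))) := by
      simp only [blocks, sweep_append, sweep_look_block_length, List.flatMap_cons, List.cons_append,
        sweep, sweepCell, Option.bind_some, hy, hz, Option.map_some]
    rw [verdict, hs]
    simp only [h₁, h₂]
    rw [Bool.eq_iff_iff]
    cases rs <;> simp [eq_comm (a := r)]

theorem sweep_passed_blocks {i : ℕ} {r : List Bool} {b : Bool} (hb : r[i]? = some b)
    {rs : List (List Bool)} (h : ∀ s ∈ rs, i < s.length) :
    sweep (passed b) (rs.flatMap fun s => sep :: block i r s) =
      some (passed b, rs.flatMap fun s => sep :: block (i + 1) r s) := by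
  induction rs with
  | nil => rfl
  | cons s rs ih =>
    simp only [List.flatMap_cons, List.cons_append, sweep, sweepCell, Option.bind_some,
      sweep_append, sweep_seek_block hb (h s (by simp)), ih fun s hs => h s (by simp [hs]),
      Option.map_some]

/-- If one of the blocks has no unprocessed bit left, a comparing sweep ends inside or at the end of
such a block. -/
theorem sweep_passed_blocks_of_short {i : ℕ} {r : List Bool} {b : Bool} (hb : r[i]? = some b)
    {rs : List (List Bool)} (h : ∀ s ∈ rs, i ≤ s.length) (h' : ∃ s ∈ rs, s.length = i) :
    ∀ q y, sweep (passed b) (rs.flatMap fun s => sep :: block i r s) = some (q, y) → q = seek b := by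
  induction rs with
  | nil => simp at h'
  | cons s rs ih =>
    intro q y
    simp only [List.flatMap_cons, List.cons_append, sweep, sweepCell, Option.bind_some,
      sweep_append]
    rcases (h s (by simp)).eq_or_lt with hs | hs
    · subst hs
      rw [sweep_seek_block_length]
      cases rs with
      | nil =>
        simp only [List.flatMap_nil, sweep, Option.bind_some, Option.map_some, Option.some_inj,
          Prod.mk.injEq]
        exact fun h => h.1.symm
      | cons s' rs => simp [sweep, sweepCell]
    · rw [sweep_seek_block hb hs]
      have h'' : ∃ s ∈ rs, s.length = i := by
        obtain ⟨s', hs', rfl⟩ := h'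
        rcases List.mem_cons.1 hs' with rfl | hs'
        · omega
        · exact ⟨s', hs', rfl⟩
      have ih := ih (fun s hs => h s (by simp [hs])) h''
      rcases hq : sweep (passed b) (rs.flatMap fun s => sep :: block i r s) with _ | ⟨q', y'⟩
      · simp [hq]
      · have := ih q' y' hq
        simp only [Option.bind_some, hq, Option.map_some, Option.some_inj, Prod.mk.injEq]
        rintro ⟨rfl, -⟩
        exact this

/-- At a separator, `found b` and `passed b` act in the same way. -/
theorem sweep_found_blocks (i : ℕ) (r : List Bool) (b : Bool) (s : List Bool)
    (rs : List (List Bool)) :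
    sweep (found b) ((s :: rs).flatMap fun s => sep :: block i r s) =
      sweep (passed b) ((s :: rs).flatMap fun s => sep :: block i r s) := by
  simp only [List.flatMap_cons, List.cons_append, sweep, sweepCell]

/-- Each round before the last one processes one bit of each block, hence the number of rounds that
are needed exceeds the length of the last block by one. -/
theorem verdict_blocks {r : List Bool} {rs : List (List Bool)} {i : ℕ} (j : ℕ) (hr : i ≤ r.length)
    (h : ∀ s ∈ rs, i ≤ s.length) :
    verdict j (blocks i r rs) = decide (r.length < i + j ∧ (∀ s ∈ rs, r.length ≤ s.length) ∧
      2 ≤ rs.length ∧ r ∈ rs) := by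
  induction j generalizing i with
  | zero => simp [verdict, hr]
  | succ j ih =>
    rcases hr.eq_or_lt with rfl | hi
    · rw [verdict_check h]
      simp only [decide_eq_decide]
      exact ⟨fun h' => ⟨by omega, h, h'⟩, fun h' => h'.2.2⟩
    · obtain ⟨b, hb⟩ : ∃ b, r[i]? = some b := ⟨r[i], by simp [hi]⟩
      cases rs with
      | nil => simp [verdict, blocks, sweep_look_block hb]
      | cons s rs =>
        by_cases hshort : ∃ s' ∈ s :: rs, s'.length = i
        · have hq := sweep_passed_blocks_of_short hb h hshort
          have hfalse : ¬ (r.length < i + (j + 1) ∧ (∀ s' ∈ s :: rs, r.length ≤ s'.length) ∧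
              2 ≤ (s :: rs).length ∧ r ∈ s :: rs) := by
            rintro ⟨-, h', -⟩
            obtain ⟨s', hs', rfl⟩ := hshort
            exact absurd (h' s' hs') (by omega)
          rw [decide_eq_false hfalse, verdict, blocks, sweep_append, sweep_look_block hb,
            Option.bind_some, sweep_found_blocks]
          rcases hs : sweep (passed b) ((s :: rs).flatMap fun s => sep :: block i r s)
            with _ | ⟨q, y⟩
          · rfl
          · rw [hq q y hs]
            rfl
        · have hlt : ∀ s' ∈ s :: rs, i < s'.length := fun s' hs' =>
            (h s' hs').lt_of_ne fun he => hshort ⟨s', hs', he.symm⟩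
          have hs : sweep look (blocks i r (s :: rs)) =
              some (passed b, blocks (i + 1) r (s :: rs)) := by
            rw [blocks, sweep_append, sweep_look_block hb, Option.bind_some, sweep_found_blocks,
              sweep_passed_blocks hb hlt]
            rfl
          rw [verdict, hs]
          simp only
          rw [ih hi hlt]
          simp only [decide_eq_decide]
          rw [Nat.succ_add_eq_add_succ]

/-- The payload of an input symbol. -/
def payload : Option Bool → Payload
  | some b => bit b
  | none => sep

theorem reverse_map_payload_blockWord (us : List (List Bool)) (v : List Bool) :
    ((blockWord (us ++ [v])).map payload).reverse =
      blocks 0 v.reverse (us.reverse.map List.reverse) := by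
  have hbits : ∀ u : List Bool, (u.map some).map payload = u.map bit := by
    intro u
    simp [payload, Function.comp_def]
  rw [blockWord_append_singleton, blocks]
  simp only [List.map_append, List.reverse_append, hbits, block, List.map_reverse]
  congr 1
  induction us with
  | nil => rfl
  | cons u us ih =>
    rw [List.flatMap_cons, List.map_append, List.reverse_append, ih]
    simp [hbits, payload]

theorem verdict_eq_true_iff (n : ℕ) (w : List (Option Bool)) :
    verdict (n + 1) (w.map payload).reverse = true ↔ w ∈ blockLanguage n := by
  obtain ⟨us, v, rfl⟩ := exists_blockWord w
  rw [reverse_map_payload_blockWord, verdict_blocks _ (Nat.zero_le _) fun _ _ => Nat.zero_le _,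
    blockWord_mem_blockLanguage, decide_eq_true_iff]
  simp only [zero_add, List.length_reverse, Nat.lt_succ_iff, List.mem_map, List.mem_reverse,
    forall_exists_index, and_imp, forall_apply_eq_imp_iff₂, List.length_map,
    List.reverse_injective.eq_iff, exists_eq_right]
  tauto

end BlockMachine

/-! ### Configurations given by lists -/

namespace OneTapeTM

variable {α Q Γ : Type*}

/-- The configuration whose tape holds the list `L`, read from right to left, to the left of the
boundary `b`, and the list `R` to the right of it; the head scans the first cell of `R`. -/
def facingRight (M : OneTapeTM α Q Γ) (b : ℤ) (q : Q) (L R : List Γ) : TMConfig Q Γ :=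
  rightConfig b q (fun i => L.getD i M.blank) (fun i => R.getD i M.blank) 0

/-- As `facingRight`, but the head scans the first cell of `L`. -/
def facingLeft (M : OneTapeTM α Q Γ) (b : ℤ) (q : Q) (L R : List Γ) : TMConfig Q Γ :=
  leftConfig b q (fun i => L.getD i M.blank) (fun i => R.getD i M.blank) 0

theorem update_getD_cons (d a a' : Γ) (L : List Γ) :
    Function.update (fun i => (a :: L).getD i d) 0 a' = fun i => (a' :: L).getD i d := by
  funext i
  cases i with
  | zero => simp
  | succ i => simp

/-- Moving the boundary by one cell moves one symbol from one half tape to the other. -/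
theorem glue_shift (b : ℤ) (d a : Γ) (L R : List Γ) :
    glue b (fun i => L.getD i d) (fun i => (a :: R).getD i d) =
      glue (b + 1) (fun i => (a :: L).getD i d) (fun i => R.getD i d) := by
  funext z
  rcases lt_trichotomy z b with h | rfl | h
  · have e : (b + 1 - 1 - z).toNat = (b - 1 - z).toNat + 1 := by omega
    rw [glue, if_pos h, glue, if_pos (by omega), e, List.getD_cons_succ]
  · have e : (z + 1 - 1 - z).toNat = 0 := by omega
    rw [glue, if_neg (lt_irrefl _), glue, if_pos (by omega), e, sub_self, Int.toNat_zero]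
    rfl
  · have e : (z - b).toNat = (z - (b + 1)).toNat + 1 := by omega
    rw [glue, if_neg (by omega), glue, if_neg (by omega), e, List.getD_cons_succ]

variable (M : OneTapeTM α Q Γ) (b : ℤ) {q q' : Q} {a a' : Γ} (L R : List Γ)

theorem isHalting_facingRight : M.IsHalting (M.facingRight b q L (a :: R)) ↔ M.δ q a = none :=
  M.isHalting_rightConfig b _ _

theorem isHalting_facingLeft : M.IsHalting (M.facingLeft b q (a :: L) R) ↔ M.δ q a = none :=
  M.isHalting_leftConfig b _ _

theorem step_facingRight_right (h : M.δ q a = some (q', a', .right)) :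
    M.step (M.facingRight b q L (a :: R)) = some (M.facingRight (b + 1) q' (a' :: L) R) := by
  rw [facingRight, M.step_rightConfig_right b _ _ h, update_getD_cons, rightConfig, glue_shift]
  simp [facingRight, rightConfig]

theorem step_facingRight_left (h : M.δ q a = some (q', a', .left)) :
    M.step (M.facingRight b q L (a :: R)) = some (M.facingLeft b q' L (a' :: R)) := by
  rw [facingRight, M.step_rightConfig_exit b _ _ h, update_getD_cons]
  rfl

theorem step_facingLeft_left (h : M.δ q a = some (q', a', .left)) :
    M.step (M.facingLeft b q (a :: L) R) = some (M.facingLeft (b - 1) q' L (a' :: R)) := by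
  rw [facingLeft, M.step_leftConfig_left b _ _ h, update_getD_cons, facingLeft, leftConfig,
    leftConfig, glue_shift, sub_add_cancel]
  simp

theorem step_facingLeft_right (h : M.δ q a = some (q', a', .right)) :
    M.step (M.facingLeft b q (a :: L) R) = some (M.facingRight b q' (a' :: L) R) := by
  rw [facingLeft, M.step_leftConfig_exit b _ _ h, update_getD_cons]
  rfl

theorem facingRight_append_blank :
    M.facingRight b q (L ++ [M.blank]) (R ++ [M.blank]) = M.facingRight b q L R := by
  have h : ∀ L : List Γ, (fun i => (L ++ [M.blank]).getD i M.blank) = fun i => L.getD i M.blank := by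
    intro L
    funext i
    rcases lt_or_ge i L.length with h | h
    · rw [List.getD_append _ _ _ _ h]
    · rw [List.getD_append_right _ _ _ _ h, List.getD_eq_default _ _ h]
      cases i - L.length <;> simp
  rw [facingRight, h, h, facingRight]

end OneTapeTM

/-! ### The machines for the block language -/

namespace BlockMachine

open Payload Phase

/-- The symbols that have no counter. -/
inductive Special
  | blank
  | lend
  | rend
  deriving DecidableEq

instance : Fintype Special :=
  ⟨{.blank, .lend, .rend}, fun x => by cases x <;> simp⟩

/-- The working alphabet: the special symbols, and pairs that consist of a payload or, for cells that
were blank at the beginning, of `none`, and of a counter of the remaining rewritings. -/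
abbrev Sym (N : ℕ) : Type := Special ⊕ (Option Payload × Fin (N + 1))

/-- The decreased counter. -/
def dec {N : ℕ} (c : Fin (N + 1)) : Fin (N + 1) := ⟨c.val - 1, by omega⟩

theorem dec_val_lt {N : ℕ} {c : Fin (N + 1)} (hc : 0 < c.val) : (dec c).val < c.val :=
  Nat.sub_lt hc Nat.one_pos

/-- The change of the direction at the two ends of the input. -/
def turn : Phase → Option (Phase × Turing.Dir)
  | forth => some (look, .left)
  | passed _ => some (forth, .right)
  | _ => none

/-- The action on the payloads. -/
def move : Phase → Payload → Option (Phase × Payload × Turing.Dir)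
  | forth, p => some (forth, p, .right)
  | q, p => (sweepCell q p).map fun r => (r.1, r.2, .left)

/-- The transition function, with endmarkers if `e` is true. Otherwise the ends of the input are
recognized by blank cells, which receive counters when they are visited for the first time. -/
def trans (e : Bool) (N : ℕ) : Phase → Sym N → Option (Phase × Sym N × Turing.Dir)
  | q, .inr (x, c) =>
    if 0 < c.val then
      match x with
      | some p => (move q p).map fun r => (r.1, .inr (some r.2.1, dec c), r.2.2)
      | none => (turn q).map fun r => (r.1, .inr (none, dec c), r.2)
    else none
  | q, .inl .blank =>
    if e then none else (turn q).map fun r => (r.1, .inr (none, Fin.last N), r.2)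
  | passed _, .inl .lend => if e then some (forth, .inl .lend, .right) else none
  | forth, .inl .rend => if e then some (look, .inl .rend, .left) else none
  | _, _ => none

/-- The weight of a symbol is its counter; the special symbols are heavier than all the others. -/
def weight {N : ℕ} : Sym N → ℕ
  | .inr (_, c) => c
  | _ => N + 1

/-- Except for endmarkers, which are rewritten by themselves, every rewriting yields a symbol with a
counter and decreases the weight. -/
theorem weight_lt {e : Bool} {N : ℕ} {q q' : Phase} {s t : Sym N} {d : Turing.Dir}
    (h : trans e N q s = some (q', t, d)) :
    (∃ x, t = .inr x ∧ weight t < weight s) ∨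
      (e = true ∧ s = .inl .lend ∧ t = .inl .lend ∧ d = .right) ∨
      (e = true ∧ s = .inl .rend ∧ t = .inl .rend ∧ d = .left) := by
  rcases s with (_ | _ | _) | ⟨x, c⟩
  · left
    simp only [trans, Option.ite_none_left_eq_some, Option.map_eq_some_iff, Prod.mk.injEq] at h
    obtain ⟨-, r, -, -, rfl, -⟩ := h
    exact ⟨_, rfl, by simp [weight]⟩
  · right; left
    cases q <;> simp_all [trans]
  · right; right
    cases q <;> simp_all [trans]
  · left
    simp only [trans, Option.ite_none_right_eq_some] at h
    obtain ⟨hc, h⟩ := h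
    rcases x with _ | p <;> simp only [Option.map_eq_some_iff, Prod.mk.injEq] at h <;>
      obtain ⟨r, -, -, rfl, -⟩ := h <;> exact ⟨_, rfl, dec_val_lt hc⟩

theorem payload_injective : Function.Injective payload := by
  rintro (_ | a) (_ | b) h <;> simp_all [payload]

/-- The sweeping machine. Without endmarkers, it starts with a sweep to the right; with endmarkers,
it starts in a state that turns to the right at the left endmarker. -/
def machine (e : Bool) (N : ℕ) : OneTapeTM (Option Bool) Phase (Sym N) where
  inp := ⟨fun a => .inr (some (payload a), Fin.last N), fun a b h => payload_injective (by
    simpa using h)⟩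
  blank := .inl .blank
  inp_ne_blank := by simp
  δ := trans e N
  write_ne_blank := by
    intro p s q t d h
    rcases weight_lt h with ⟨x, rfl, -⟩ | ⟨-, -, rfl, -⟩ | ⟨-, -, rfl, -⟩ <;> simp
  q₀ := if e then passed false else forth
  F := {q | ∃ f a t, q = check f a t ∧ ((f || a) && t) = true}

/-- The end-marked machine. -/
def markedMachine (N : ℕ) : EndMarkedTM (Option Bool) Phase (Sym N) where
  __ := machine true N
  lend := .inl .lend
  rend := .inl .rend
  lend_ne_rend := by simp
  lend_ne_blank := by simp [machine]
  rend_ne_blank := by simp [machine]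
  inp_ne_lend := by simp [machine]
  inp_ne_rend := by simp [machine]
  δ_lend := by
    intro p q t d h
    rcases weight_lt h with ⟨x, rfl, h⟩ | ⟨-, -, rfl, rfl⟩ | ⟨-, h, -⟩
    · cases p <;> simp_all [machine, trans]
    · exact ⟨rfl, rfl⟩
    · simp at h
  δ_rend := by
    intro p q t d h
    rcases weight_lt h with ⟨x, rfl, h⟩ | ⟨-, h, -⟩ | ⟨-, -, rfl, rfl⟩
    · cases p <;> simp_all [machine, trans]
    · simp at h
    · exact ⟨rfl, rfl⟩

/-- The cells with the payloads `x` and the counter `c`. -/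
def cells {N : ℕ} (c : Fin (N + 1)) (x : List Payload) : List (Sym N) :=
  x.map fun p => .inr (some p, c)

/-- The symbols of a cell next to the input in which the head can turn `k` more times: the endmarker
`m` if there are endmarkers, a blank or a cell with counter at least `k` otherwise. -/
def IsEnd (e : Bool) {N : ℕ} (m : Special) (k : ℕ) (g : Sym N) : Prop :=
  if e then g = .inl m
  else k ≤ N ∧ (g = .inl .blank ∨ ∃ c : Fin (N + 1), k ≤ c.val ∧ g = .inr (none, c))

theorem IsEnd.mono {e : Bool} {N : ℕ} {m : Special} {k k' : ℕ} {g : Sym N} (h : IsEnd e m k g)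
    (hk : k' ≤ k) : IsEnd e m k' g := by
  cases e with
  | true => exact h
  | false =>
    obtain ⟨h, h'⟩ := h
    exact ⟨hk.trans h, h'.imp_right fun ⟨c, hc, h⟩ => ⟨c, hk.trans hc, h⟩⟩

/-- Endmarkers, blank cells and cells with a positive counter all make the head turn, at the cost of
one of the remaining visits. -/
theorem IsEnd.trans_turn {e : Bool} {N : ℕ} {m : Special} {k : ℕ} {g : Sym N} (h : IsEnd e m (k + 1) g)
    {q : Phase} {d : Turing.Dir}
    (hm : m = .lend ∧ d = .right ∧ (∃ b, q = passed b) ∨ m = .rend ∧ d = .left ∧ q = forth) :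
    ∃ g', IsEnd e m k g' ∧
      trans e N q g = some (if d = .right then forth else look, g', d) := by
  cases e with
  | true =>
    obtain rfl : g = .inl m := h
    refine ⟨.inl m, rfl, ?_⟩
    rcases hm with ⟨rfl, rfl, b, rfl⟩ | ⟨rfl, rfl, rfl⟩ <;> rfl
  | false =>
    obtain ⟨h, rfl | ⟨c, hc, rfl⟩⟩ := h
    · refine ⟨.inr (none, Fin.last N), ⟨by omega, .inr ⟨_, by simp; omega, rfl⟩⟩, ?_⟩
      rcases hm with ⟨rfl, rfl, b, rfl⟩ | ⟨rfl, rfl, rfl⟩ <;> simp [trans, turn]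
    · refine ⟨.inr (none, dec c), ⟨by omega, .inr ⟨_, by simp [dec]; omega, rfl⟩⟩, ?_⟩
      have hc' : 0 < c.val := by omega
      rcases hm with ⟨rfl, rfl, b, rfl⟩ | ⟨rfl, rfl, rfl⟩ <;>
        simp only [trans, if_pos hc', turn] <;> simp

theorem IsEnd.halt {e : Bool} {N : ℕ} {k : ℕ} {g : Sym N} (h : IsEnd e .lend k g)
    {q : Phase} (hq : turn q = none) : trans e N q g = none := by
  cases e with
  | true =>
    obtain rfl : g = .inl .lend := h
    cases q <;> simp_all [trans, turn]
  | false =>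
    obtain ⟨h, rfl | ⟨c, hc, rfl⟩⟩ := h <;> simp [trans, hq]

theorem machine_cell (e : Bool) {N : ℕ} {c : Fin (N + 1)} (hc : 0 < c.val) (q : Phase)
    (p : Payload) :
    (machine e N).δ q (.inr (some p, c)) =
      (move q p).map fun r => (r.1, .inr (some r.2.1, dec c), r.2.2) := by
  simp only [machine, trans, if_pos hc]

theorem move_of_ne_forth {q : Phase} (hq : q ≠ forth) (p : Payload) :
    move q p = (sweepCell q p).map fun r => (r.1, r.2, .left) := by
  cases q <;> first | rfl | exact absurd rfl hq

theorem sweepCell_ne_forth {q q' : Phase} {p p' : Payload} (h : sweepCell q p = some (q', p')) :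
    q' ≠ forth := by
  rintro rfl
  cases q <;> cases p <;> simp [sweepCell] at h
  all_goals split at h <;> simp at h

theorem sweepCell_eq_none {e : Bool} {N : ℕ} {q : Phase} {p : Payload} (h : sweepCell q p = none) :
    q ∉ (machine e N).F := by
  rintro ⟨f, a, t, rfl, -⟩
  rcases p with b | (_ | _) | _ <;> simp [sweepCell] at h

variable {e : Bool} {N : ℕ} {c : Fin (N + 1)}

theorem reachesIn_forth (hc : 0 < c.val) (b : ℤ) (x : List Payload) (L R : List (Sym N)) :
    (machine e N).ReachesIn x.length ((machine e N).facingRight b forth L (cells c x ++ R))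
      ((machine e N).facingRight (b + x.length) forth ((cells (dec c) x).reverse ++ L) R) := by
  induction x generalizing b L with
  | nil => simp [OneTapeTM.reachesIn_zero, cells]
  | cons p x ih =>
    refine .head ((machine e N).step_facingRight_right b _ _ (machine_cell e hc forth p)) ?_
    have h := ih (b + 1) (.inr (some p, dec c) :: L)
    have hb : b + 1 + x.length = b + (p :: x).length := by simp; ring
    rw [hb] at h
    simpa [cells] using h

theorem reachesIn_sweep (hc : 0 < c.val) (b : ℤ) {q q' : Phase} {y y' : List Payload}
    (hq : q ≠ forth) (h : sweep q y = some (q', y')) (L R : List (Sym N)) :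
    (machine e N).ReachesIn y.length ((machine e N).facingLeft b q (cells c y ++ L) R)
      ((machine e N).facingLeft (b - y.length) q' L ((cells (dec c) y').reverse ++ R)) := by
  induction y generalizing b q y' R with
  | nil =>
    simp only [sweep, Option.some_inj, Prod.mk.injEq] at h
    obtain ⟨rfl, rfl⟩ := h
    simp [OneTapeTM.reachesIn_zero, cells]
  | cons p y ih =>
    simp only [sweep, Option.bind_eq_some_iff, Option.map_eq_some_iff] at h
    obtain ⟨⟨q₁, p₁⟩, h₁, ⟨q₂, y₂⟩, h₂, h₃⟩ := h
    cases h₃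
    have hδ : (machine e N).δ q (.inr (some p, c)) = some (q₁, .inr (some p₁, dec c), .left) := by
      rw [machine_cell e hc, move_of_ne_forth hq, h₁]
      rfl
    refine .head ((machine e N).step_facingLeft_left b _ _ hδ) ?_
    have h := ih (b - 1) (sweepCell_ne_forth h₁) h₂ (.inr (some p₁, dec c) :: R)
    have hb : b - 1 - y.length = b - (p :: y).length := by simp; ring
    rw [hb] at h
    simpa [cells] using h

theorem reachesIn_sweep_none (hc : 0 < c.val) (b : ℤ) {q : Phase} {y : List Payload}
    (hq : q ≠ forth) (h : sweep q y = none) (L R : List (Sym N)) :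
    ∃ t ≤ y.length, ∃ d,
      (machine e N).ReachesIn t ((machine e N).facingLeft b q (cells c y ++ L) R) d ∧
        (machine e N).IsHalting d ∧ d.state ∉ (machine e N).F := by
  induction y generalizing b q R with
  | nil => simp [sweep] at h
  | cons p y ih =>
    rcases h₁ : sweepCell q p with _ | ⟨q₁, p₁⟩
    · refine ⟨0, Nat.zero_le _, _, OneTapeTM.reachesIn_zero.2 rfl, ?_, sweepCell_eq_none h₁⟩
      refine ((machine e N).isHalting_facingLeft b _ _).2 ?_
      rw [machine_cell e hc, move_of_ne_forth hq, h₁]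
      rfl
    · simp only [sweep, h₁, Option.bind_some, Option.map_eq_none_iff] at h
      obtain ⟨t, ht, d, hd, hd'⟩ :=
        ih (b - 1) (sweepCell_ne_forth h₁) h (.inr (some p₁, dec c) :: R)
      refine ⟨t + 1, by simpa using ht, d, ?_, hd'⟩
      refine .head ((machine e N).step_facingLeft_left b _ _ ?_) hd
      rw [machine_cell e hc, move_of_ne_forth hq, h₁]
      rfl

end BlockMachine

namespace BlockMachine

open Payload Phase

variable {e : Bool} {N : ℕ}

theorem cells_reverse (c : Fin (N + 1)) (x : List Payload) :
    (cells c x).reverse = cells c x.reverse := by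
  simp [cells]

theorem verdict_eq_of_halt {j : ℕ} {y y' : List Payload} {q : Phase}
    (h : sweep look y = some (q, y')) (hq : turn q = none) :
    q ∈ (machine e N).F ↔ verdict (j + 1) y = true := by
  rw [verdict, h]
  cases q with
  | check f a t =>
    refine ⟨?_, fun h => ⟨f, a, t, rfl, h⟩⟩
    rintro ⟨f, a, t, h, h'⟩
    cases h
    exact h'
  | _ => simp_all [machine, turn]

theorem sweep_ne_forth {q q' : Phase} {y y' : List Payload} (hq : q ≠ forth)
    (h : sweep q y = some (q', y')) : q' ≠ forth := by
  induction y generalizing q y' with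
  | nil =>
    simp only [sweep, Option.some_inj, Prod.mk.injEq] at h
    exact h.1 ▸ hq
  | cons p y ih =>
    simp only [sweep, Option.bind_eq_some_iff, Option.map_eq_some_iff] at h
    obtain ⟨⟨q₁, p₁⟩, h₁, ⟨q₂, y₂⟩, h₂, h₃⟩ := h
    cases h₃
    exact ih (sweepCell_ne_forth h₁) h₂

/-- With the counter `2 * j`, the machine carries out at most `j` rounds. If it tries to begin
another one, it halts on the exhausted counter of the first cell. -/
theorem exists_reachesIn_halting (j : ℕ) {c : Fin (N + 1)} {gl gr : Sym N} (b : ℤ)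
    (x : List Payload) (hc : c.val = 2 * j) (hl : IsEnd e .lend (2 * j) gl)
    (hr : IsEnd e .rend (2 * j) gr) (hx : x = [] → 0 < j) :
    ∃ t ≤ (j + 1) * (2 * x.length + 2), ∃ d,
      (machine e N).ReachesIn t ((machine e N).facingRight b forth [gl] (cells c x ++ [gr])) d ∧
        (machine e N).IsHalting d ∧ (d.state ∈ (machine e N).F ↔ verdict j x.reverse = true) := by
  induction j generalizing c gl gr b x with
  | zero =>
    cases x with
    | nil => exact absurd (hx rfl) (lt_irrefl 0)
    | cons p x =>
      refine ⟨0, Nat.zero_le _, _, OneTapeTM.reachesIn_zero.2 rfl, ?_, ?_⟩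
      · refine ((machine e N).isHalting_facingRight b _ _).2 ?_
        have hc' : ¬ 0 < c.val := by omega
        simp only [machine, trans, if_neg hc']
      · simp [OneTapeTM.facingRight, rightConfig, machine, verdict]
  | succ j ih =>
    have hc₁ : (dec c).val = 2 * j + 1 := by simp only [dec]; omega
    have hc₂ : (dec (dec c)).val = 2 * j := by
      rw [dec]
      simp only [hc₁]
      omega
    obtain ⟨gr', hr', hδr⟩ :=
      (show IsEnd e .rend (2 * j + 1 + 1) gr from hr).trans_turn (.inr ⟨rfl, rfl, rfl⟩)
    have h₁ := reachesIn_forth (e := e) (by omega : 0 < c.val) b x [gl] [gr]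
    have h₂ := h₁.trans (.head ((machine e N).step_facingRight_left _ _ _ hδr)
      (OneTapeTM.reachesIn_zero.2 rfl))
    rw [cells_reverse] at h₂
    simp only [reduceCtorEq, if_false] at h₂
    have hpos : 0 < (dec c).val := by omega
    rcases hs : sweep look x.reverse with _ | ⟨q, y⟩
    · obtain ⟨t, ht, d, hd, hd₁, hd₂⟩ := reachesIn_sweep_none (e := e) hpos (b + x.length)
        (by simp) hs [gl] [gr']
      refine ⟨_, ?_, d, h₂.trans hd, hd₁, by simp [hd₂, verdict, hs]⟩
      rw [List.length_reverse] at ht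
      nlinarith
    · have h₃ := h₂.trans
        (reachesIn_sweep (e := e) hpos (b + x.length) (by simp) hs [gl] [gr'])
      rw [cells_reverse] at h₃
      rcases hq : turn q with _ | r
      · refine ⟨_, ?_, _, h₃, ((machine e N).isHalting_facingLeft _ _ _).2 (hl.halt hq),
          verdict_eq_of_halt hs hq⟩
        rw [List.length_reverse]
        nlinarith
      · have hforth : q ≠ forth := sweep_ne_forth (by simp) hs
        obtain ⟨a, rfl⟩ : ∃ a, q = passed a := by
          cases q <;> simp_all [turn]
        obtain ⟨gl', hl', hδl⟩ :=
          (show IsEnd e .lend (2 * j + 1 + 1) gl from hl).trans_turn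
            (.inl ⟨rfl, rfl, a, rfl⟩)
        have h₄ := h₃.trans (.head ((machine e N).step_facingLeft_right _ _ _ hδl)
          (OneTapeTM.reachesIn_zero.2 rfl))
        simp only [if_true] at h₄
        have hlen : y.length = x.length := by
          rw [sweep_length hs, List.length_reverse]
        have hy : y.reverse = [] → 0 < j := by
          intro hy
          rw [List.reverse_eq_nil_iff.1 hy, List.length_nil, eq_comm, List.length_eq_zero_iff] at hlen
          simp [hlen, sweep] at hs
        obtain ⟨t, ht, d, hd, hd₁, hd₂⟩ := ih (b + x.length - x.reverse.length) y.reverse hc₂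
          (hl'.mono (by omega)) (hr'.mono (by omega)) hy
        refine ⟨_, ?_, d, h₄.trans hd, hd₁, hd₂.trans ?_⟩
        · rw [List.length_reverse, hlen] at ht
          rw [List.length_reverse]
          calc _ ≤ x.length + (0 + 1) + x.length + (0 + 1) + (j + 1) * (2 * x.length + 2) := by
                gcongr
            _ = (j + 1 + 1) * (2 * x.length + 2) := by ring
        · rw [verdict, hs, List.reverse_reverse]

end BlockMachine

namespace BlockMachine

open Payload Phase

/-- The number of rewritings of each cell that are needed for `n + 1` rounds. -/
abbrev rewritings (n : ℕ) : ℕ := 2 * (n + 1)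

theorem exists_reachesIn_halting_input (e : Bool) (n : ℕ) {gl gr : Sym (rewritings n)} (b : ℤ)
    (hl : IsEnd e .lend (rewritings n) gl) (hr : IsEnd e .rend (rewritings n) gr)
    (w : List (Option Bool)) :
    ∃ t ≤ (n + 2) * (2 * w.length + 2), ∃ d,
      (machine e (rewritings n)).ReachesIn t ((machine e (rewritings n)).facingRight b forth [gl]
          (w.map (machine e (rewritings n)).inp ++ [gr])) d ∧
        (machine e (rewritings n)).IsHalting d ∧
        (d.state ∈ (machine e (rewritings n)).F ↔ w ∈ blockLanguage n) := by
  obtain ⟨t, ht, d, h⟩ := exists_reachesIn_halting (n + 1) b (w.map payload)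
    (Fin.val_last (rewritings n)) hl hr fun _ => Nat.succ_pos n
  rw [verdict_eq_true_iff, cells, List.map_map] at h
  rw [List.length_map] at ht
  exact ⟨t, ht, d, h⟩

theorem acceptsFrom_iff_state_mem {α Q Γ : Type*} {M : OneTapeTM α Q Γ} {t : ℕ} {c d : TMConfig Q Γ}
    (h : M.ReachesIn t c d) (hd : M.IsHalting d) : M.AcceptsFrom c ↔ d.state ∈ M.F := by
  refine ⟨?_, fun h' => ⟨t, d, h, hd, h'⟩⟩
  rintro ⟨s, d', h', hd', hF⟩
  rwa [h.halting_unique hd h' hd']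

theorem machine_language (n : ℕ) : (machine false (rewritings n)).language = blockLanguage n := by
  ext w
  have hg : ∀ m, IsEnd false (N := rewritings n) m (rewritings n) (.inl .blank) :=
    fun m => ⟨le_rfl, .inl rfl⟩
  obtain ⟨t, -, d, h, hd, hF⟩ :=
    exists_reachesIn_halting_input false n 0 (hg .lend) (hg .rend) w
  have hinit : (machine false (rewritings n)).init w =
      (machine false (rewritings n)).facingRight 0 forth [.inl .blank]
        (w.map (machine false (rewritings n)).inp ++ [.inl .blank]) := by
    refine Eq.trans ?_ ((machine false (rewritings n)).facingRight_append_blank 0 [] _).symm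
    have := tapeOfList_append (machine false (rewritings n)).blank []
      (w.map (machine false (rewritings n)).inp)
    rw [OneTapeTM.init, ← List.nil_append (w.map _), this]
    rfl
  rw [← hF, ← acceptsFrom_iff_state_mem h hd, ← hinit]
  rfl

theorem markedMachine_run (n : ℕ) (w : List (Option Bool)) :
    ∃ t ≤ (n + 2) * (2 * w.length + 2) + 1, ∃ d,
      (markedMachine (rewritings n)).ReachesIn t ((markedMachine (rewritings n)).initMarked w) d ∧
        (markedMachine (rewritings n)).IsHalting d ∧
        (d.state ∈ (markedMachine (rewritings n)).F ↔ w ∈ blockLanguage n) := by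
  obtain ⟨t, ht, d, h, hd⟩ := exists_reachesIn_halting_input true n (gl := .inl .lend)
    (gr := .inl .rend) 1 rfl rfl w
  refine ⟨t + 1, by omega, d, ?_, hd⟩
  have hinit : (markedMachine (rewritings n)).initMarked w =
      (machine true (rewritings n)).facingLeft 1 (passed false) [.inl .lend]
        (w.map (machine true (rewritings n)).inp ++ [.inl .rend]) := by
    have := tapeOfList_append (machine true (rewritings n)).blank [.inl .lend]
      (w.map (machine true (rewritings n)).inp ++ [.inl .rend])
    rw [OneTapeTM.facingLeft, leftConfig]
    simp only [List.length_singleton, Nat.cast_one, List.reverse_singleton] at this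
    rw [← this]
    rfl
  rw [hinit]
  exact .head ((machine true (rewritings n)).step_facingLeft_right _ _ _ rfl) h

theorem markedMachine_language (n : ℕ) :
    (markedMachine (rewritings n)).markedLanguage = blockLanguage n := by
  ext w
  obtain ⟨t, -, d, h, hd, hF⟩ := markedMachine_run n w
  rw [← hF, ← acceptsFrom_iff_state_mem h hd]
  rfl

/-- Every weight is strictly monotone for some partial order: different elements are comparable if
their weights differ. -/
theorem exists_partialOrder {β : Type*} (wt : β → ℕ) :
    ∃ _ : PartialOrder β, ∀ s t : β, wt s < wt t → s < t := by
  refine ⟨{ le := fun s t => s = t ∨ wt s < wt t, le_refl := fun s => .inl rfl, le_trans := ?_,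
            le_antisymm := ?_ }, fun s t h => ⟨.inr h, ?_⟩⟩
  · rintro r s t (rfl | h) (rfl | h')
    · exact .inl rfl
    · exact .inr h'
    · exact .inr h
    · exact .inr (h.trans h')
  · rintro s t (h | h) (h' | h')
    · exact h
    · exact h
    · exact h'.symm
    · exact absurd (h.trans h') (lt_irrefl _)
  · rintro (rfl | h')
    · exact lt_irrefl _ h
    · exact lt_irrefl _ (h.trans h')

theorem machine_weightReducing (n : ℕ) : (machine false (rewritings n)).WeightReducing := by
  obtain ⟨o, h⟩ := exists_partialOrder (weight (N := rewritings n))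
  refine ⟨o, fun p s q t d hδ => h _ _ ?_⟩
  rcases weight_lt hδ with ⟨-, -, h⟩ | ⟨h, -⟩ | ⟨h, -⟩
  · exact h
  · cases h
  · cases h

theorem markedMachine_isWeightReducingHennie (n : ℕ) :
    (markedMachine (rewritings n)).IsWeightReducingHennie := by
  constructor
  · refine ⟨2 * (n + 2), 2 * (n + 2) + 1, fun w => ?_⟩
    obtain ⟨t, ht, d, h, hd, -⟩ := markedMachine_run n w
    exact ⟨t, ht.trans (le_of_eq (by ring)), d, h, hd⟩
  · obtain ⟨o, h⟩ := exists_partialOrder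
      fun s : {s : Sym (rewritings n) // s ≠ (markedMachine (rewritings n)).lend ∧
        s ≠ (markedMachine (rewritings n)).rend} => weight s.1
    refine ⟨o, fun p s q t d hδ => ?_⟩
    rcases weight_lt hδ with ⟨x, rfl, hw⟩ | ⟨-, hs, -⟩ | ⟨-, hs, -⟩
    · exact ⟨⟨Sum.inr_ne_inl, Sum.inr_ne_inl⟩, h _ _ hw⟩
    · exact absurd hs s.2.1
    · exact absurd hs s.2.2

theorem card_sym (n : ℕ) : Fintype.card (Sym (rewritings n)) ≤ 21 * (n + 1) := by
  have h₁ : Fintype.card Special = 3 := rfl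
  have h₂ : Fintype.card Payload = 5 := rfl
  simp only [Fintype.card_sum, Fintype.card_prod, Fintype.card_option, Fintype.card_fin, h₁, h₂,
    rewritings]
  omega

/-- The size of a machine with at most `21 (n + 1)` working symbols. The number of states does not
depend on `n`. -/
theorem size_le {α Q Γ : Type*} [Fintype Q] [Fintype Γ] (M : OneTapeTM α Q Γ) (n : ℕ)
    (hΓ : Fintype.card Γ ≤ 21 * (n + 1)) :
    M.size ≤ (Fintype.card Q * 21 * (Fintype.card Q * 42 + 2) + Fintype.card Q) *
      ((n + 1) * Nat.log 2 (n + 2)) := by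
  unfold OneTapeTM.size
  set s := Fintype.card Q
  have hl : 1 ≤ Nat.log 2 (n + 2) := Nat.log_pos (by norm_num) (by omega)
  have hn : n + 2 < 2 ^ (Nat.log 2 (n + 2) + 1) := Nat.lt_pow_succ_log_self (by norm_num) _
  set l := Nat.log 2 (n + 2)
  have hs : s * 42 + 1 ≤ 2 ^ (s * 42) := Nat.lt_two_pow_self
  have hc : Nat.clog 2 (2 * s * Fintype.card Γ + 1) ≤ s * 42 + (l + 1) := by
    apply Nat.clog_le_of_le_pow
    calc 2 * s * Fintype.card Γ + 1 ≤ 2 * s * (21 * (n + 1)) + 1 := by gcongr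
      _ ≤ (s * 42 + 1) * (n + 2) := by nlinarith
      _ ≤ 2 ^ (s * 42) * 2 ^ (l + 1) := Nat.mul_le_mul hs hn.le
      _ = 2 ^ (s * 42 + (l + 1)) := (pow_add _ _ _).symm
  have hc' : s * 42 + (l + 1) ≤ (s * 42 + 2) * l := by nlinarith
  have hnl : 1 ≤ (n + 1) * l := Nat.mul_pos (Nat.succ_pos n) hl
  calc s * Fintype.card Γ * Nat.clog 2 (2 * s * Fintype.card Γ + 1) + s
      ≤ s * (21 * (n + 1)) * ((s * 42 + 2) * l) + s * ((n + 1) * l) := by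
        gcongr
        · exact hc.trans hc'
        · exact Nat.le_mul_of_pos_right _ hnl
    _ = (s * 21 * (s * 42 + 2) + s) * ((n + 1) * l) := by ring

/-- A constant for the three bounds on the machines for the block language. -/
def sizeConstant : ℕ :=
  Fintype.card Phase * 21 * (Fintype.card Phase * 42 + 2) + Fintype.card Phase + 21

theorem card_size_bounds (n : ℕ) (M : OneTapeTM (Option Bool) Phase (Sym (rewritings n))) :
    Fintype.card Phase ≤ sizeConstant ∧
      Fintype.card (Sym (rewritings n)) ≤ sizeConstant * (n + 1) ∧
      M.size ≤ sizeConstant * ((n + 1) * Nat.log 2 (n + 2)) := by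
  unfold sizeConstant
  refine ⟨by omega, (card_sym n).trans ?_, (size_le M n (card_sym n)).trans ?_⟩
  · exact Nat.mul_le_mul_right _ (Nat.le_add_left _ _)
  · exact Nat.mul_le_mul_right _ (Nat.le_add_right _ _)

end BlockMachine

theorem mainTheorem2 :
    -- upper bound, for weight-reducing one-tape machines
    (∃ C : ℕ, ∀ (α : Type u) (Q : Type v) (Γ : Type w) [Fintype α] [Fintype Q] [Fintype Γ]
      (M : OneTapeTM α Q Γ), M.WeightReducing →
        ∃ (k : ℕ) (A : DFA α (Fin k)), A.accepts = M.language ∧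
          k ≤ 2 ^ 2 ^ (C * (Fintype.card Γ * Nat.log 2 (Fintype.card Q + 1))) ∧
          A.tableSize ≤ 2 ^ 2 ^ (C * M.size)) ∧
    -- upper bound, for weight-reducing Hennie machines
    (∃ C : ℕ, ∀ (α : Type u) (Q : Type v) (Γ : Type w) [Fintype α] [Fintype Q] [Fintype Γ]
      (M : EndMarkedTM α Q Γ), M.IsWeightReducingHennie →
        ∃ (k : ℕ) (A : DFA α (Fin k)), A.accepts = M.markedLanguage ∧
          k ≤ 2 ^ 2 ^ (C * (Fintype.card Γ * Nat.log 2 (Fintype.card Q + 1))) ∧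
          A.tableSize ≤ 2 ^ 2 ^ (C * M.size)) ∧
    -- small weight-reducing Hennie machines for the witness languages
    (∃ K : ℕ, ∀ n : ℕ, ∃ (Q Γ : Type) (_ : Fintype Q) (_ : Fintype Γ)
      (M : EndMarkedTM (Option Bool) Q Γ), M.IsWeightReducingHennie ∧
        M.markedLanguage = blockLanguage n ∧
        Fintype.card Q ≤ K ∧ Fintype.card Γ ≤ K * (n + 1) ∧
        M.size ≤ K * ((n + 1) * Nat.log 2 (n + 2))) ∧
    -- small weight-reducing one-tape machines for the witness languages
    (∃ K : ℕ, ∀ n : ℕ, ∃ (Q Γ : Type) (_ : Fintype Q) (_ : Fintype Γ)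
      (M : OneTapeTM (Option Bool) Q Γ), M.WeightReducing ∧
        M.language = blockLanguage n ∧
        Fintype.card Q ≤ K ∧ Fintype.card Γ ≤ K * (n + 1) ∧
        M.size ≤ K * ((n + 1) * Nat.log 2 (n + 2))) ∧
    -- lower bound for deterministic automata, even with partial transition functions
    (∀ (n : ℕ) (σ : Type x) [Fintype σ] (A : NFA (Option Bool) σ), A.IsPartialDFA →
      A.accepts = blockLanguage n → 2 ^ 2 ^ n ≤ Fintype.card σ) := by

  refine ⟨⟨8, fun α Q Γ _ _ _ M hM => OneTapeTM.exists_small_dfa hM⟩,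
    ⟨8, fun α Q Γ _ _ _ M hM => EndMarkedTM.exists_small_dfa hM⟩,
    ⟨BlockMachine.sizeConstant, fun n => ⟨BlockMachine.Phase, _, inferInstance, inferInstance,
      BlockMachine.markedMachine (BlockMachine.rewritings n),
      BlockMachine.markedMachine_isWeightReducingHennie n, BlockMachine.markedMachine_language n,
      BlockMachine.card_size_bounds n _⟩⟩,
    ⟨BlockMachine.sizeConstant, fun n => ⟨BlockMachine.Phase, _, inferInstance, inferInstance,
      BlockMachine.machine false (BlockMachine.rewritings n),
      BlockMachine.machine_weightReducing n, BlockMachine.machine_language n,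
      BlockMachine.card_size_bounds n _⟩⟩,
    fun n σ _ A hA hL => two_pow_two_pow_le_card hA hL⟩
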